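/- **Conventions.** A plot of a diffeological space $Y$ is a smooth map $P:U\to Y$ from an open subset $U$ of some $\mathbb{R}^n$. A subset of a diffeological space is D-open if its preimage under every plot is open; the D-open sets form the D-topology, and the prefix D on a topological property refers to this topology. Subsets carry the subspace diffeology, products the product diffeology, and the set $\mathrm{C}^\infty(X,Y)$ of smooth maps carries the functional diffeology, in which $p:U\to \mathrm{C}^\infty(X,Y)$ is a plot iff $(r,x)\mapsto p(r)(x)$ is smooth on $U\times X$. For a smooth map $f:X\to Y$ and a plot $P:U\to Y$ let $P^*X=\{(r,x)\in U\times X: P(r)=f(x)\}$ and let $P^*f:P^*X\to U$, $(r,x)\mapsto r$. A smooth map $f:X\to Y$ is * a *submersion* if for every $x_0\in X$ there are a D-open $O\subseteq Y$ and a smooth $\sigma:O\to X$ with $f\circ\sigma=\mathrm{id}_O$ and $x_0\in\sigma(O)$; a *diffeological submersion* if $P^*f$ is a submersion for every plot $P$ of $Y$; * a *diffeological immersion* if for every plot $P:U\to Y$ and every $(r_0,x_0)\in P^*X$ there are a D-open neighbourhood $O$ of $(r_0,x_0)$ in $P^*X$, an open $V\subseteq U$ containing $P^*f(O)$, and a smooth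 $\varrho:V\to U\times X$ with $\varrho(P^*f(r,x))=(r,x)$ for all $(r,x)\in O$; * *étale* if every $x\in X$ has a D-open neighbourhood $O$ which $f$ maps diffeomorphically onto a D-open subset of $Y$; a *diffeological étale map* if $P^*f$ is étale for every plot $P$ of $Y$; * a *local subduction* if it is surjective and, for every $x\in X$, every plot $P:U\to Y$ and every $r_0\in U$ with $P(r_0)=f(x)$, there are an open neighbourhood $V\subseteq U$ of $r_0$ and a smooth $Q:V\to X$ with $Q(r_0)=x$ and $f\circ Q=P|_V$; * a *diffeological embedding* if it is a diffeological immersion and a topological embedding for the D-topologies; * a *diffeomorphism* if it is bijective with smooth inverse. A diffeological space is a *diffeological étale manifold* if, for some $n$, it is covered by the images of a family of diffeological étale maps defined on open subsets of $\mathbb{R}^n$. A *usual manifold* is a second-countable Hausdorff finite-dimensional smooth manifold, with the diffeology whose plots are the smooth maps. **Theorem (Stability theorem of diffeological étale manifolds).** Let $\mathcal{K}$ and $\mathcal{M}$ be diffeological étale manifolds with $\mathcal{K}$ D-compact, and equip $\mathrm{C}^{\infty}(\mathcal{K},\mathcal{M})$ with the functional diffeology. (a) The following classes are D-open subsets of $\mathrm{C}^{\infty}(\mathcal{K},\mathcal{M})$: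 (a1) diffeological submersions; (a2) diffeological immersions; (a3) diffeological étale maps; (a4) local subductions, provided that $\mathcal{M}$ is D-Hausdorff. (b) If $\mathcal{M}$ is a usual manifold, then the following classes are D-open subsets of $\mathrm{C}^{\infty}(\mathcal{K},\mathcal{M})$: (b1) injective diffeological immersions; (b2) diffeological embeddings; (b3) diffeomorphisms. (c) Let $\mathsf{Inj}^{\infty}(\mathcal{K},\mathcal{M})\subseteq\mathrm{C}^{\infty}(\mathcal{K},\mathcal{M})$ be the diffeological subspace of injective smooth maps. If $\mathcal{M}$ is D-Hausdorff, then the following classes are D-open subsets of $\mathsf{Inj}^{\infty}(\mathcal{K},\mathcal{M})$ (in the D-topology of its subspace diffeology): (c1) diffeological embeddings; (c2) diffeomorphisms. -/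

import Mathlib

open Diffeology

open scoped Topology ContDiff Manifold

noncomputable section

/-! ### Subspaces, products and mapping spaces -/

/-- The subspace diffeology: a map into a subspace is a plot iff it is a plot of the ambient
space. -/
instance Subtype.instDiffeologicalSpace {X : Type*} [DiffeologicalSpace X] {s : X → Prop} :
    DiffeologicalSpace (Subtype s) where
  plots n := {p | IsPlot (fun r : EuclideanSpace ℝ (Fin n) => (p r : X))}
  constant_plots x := isPlot_const
  plot_reparam hp hf := isPlot_reparam hp hf
  locality hp := DiffeologicalSpace.locality hp

/-- The product diffeology: a map into a product is a plot iff both components are. -/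
instance Prod.instDiffeologicalSpace {X Y : Type*} [DiffeologicalSpace X]
    [DiffeologicalSpace Y] : DiffeologicalSpace (X × Y) where
  plots n := {p | IsPlot (fun r : EuclideanSpace ℝ (Fin n) => (p r).1) ∧
    IsPlot (fun r : EuclideanSpace ℝ (Fin n) => (p r).2)}
  constant_plots x := ⟨isPlot_const, isPlot_const⟩
  plot_reparam hp hf := ⟨isPlot_reparam hp.1 hf, isPlot_reparam hp.2 hf⟩
  locality hp := by
    constructor
    · refine DiffeologicalSpace.locality fun x => ?_
      obtain ⟨u, hu, hx, h⟩ := hp x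
      exact ⟨u, hu, hx, fun h1 h2 => (h h1 h2).1⟩
    · refine DiffeologicalSpace.locality fun x => ?_
      obtain ⟨u, hu, hx, h⟩ := hp x
      exact ⟨u, hu, hx, fun h1 h2 => (h h1 h2).2⟩

/-- The set `C^∞(X, Y)` of smooth maps between diffeological spaces. -/
@[ext]
structure DSmoothMap (X Y : Type*) [DiffeologicalSpace X] [DiffeologicalSpace Y] where
  /-- The underlying function. -/
  toFun : X → Y
  /-- The underlying function is smooth. -/
  dSmooth' : DSmooth toFun

instance {X Y : Type*} [DiffeologicalSpace X] [DiffeologicalSpace Y] :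
    CoeFun (DSmoothMap X Y) (fun _ => X → Y) := ⟨DSmoothMap.toFun⟩

/-- The functional diffeology on `C^∞(X, Y)`: a map `p : ℝⁿ → C^∞(X, Y)` is a plot iff
`(r, x) ↦ p r x` is smooth on `ℝⁿ × X`. -/
instance DSmoothMap.instDiffeologicalSpace {X Y : Type*} [DiffeologicalSpace X]
    [DiffeologicalSpace Y] : DiffeologicalSpace (DSmoothMap X Y) where
  plots n := {p | DSmooth (fun z : EuclideanSpace ℝ (Fin n) × X => p z.1 z.2)}
  constant_plots f := fun n q hq => f.dSmooth' n _ hq.2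
  plot_reparam {n m p f} hp hf := fun k q hq =>
    hp k (fun r => (f (q r).1, (q r).2)) ⟨(hf.comp hq.1.contDiff).isPlot, hq.2⟩
  locality {n p} hp := by
    intro k q hq
    refine DiffeologicalSpace.locality fun r => ?_
    obtain ⟨u, hu, hx, h⟩ := hp (q r).1
    refine ⟨(fun r => (q r).1) ⁻¹' u, hu.preimage hq.1.contDiff.continuous, hx, ?_⟩
    intro m f hfu hf
    exact h (f := fun s => (q (f s)).1) hfu (hq.1.contDiff.comp hf) m
      (fun s => (s, (q (f s)).2)) ⟨isPlot_id, isPlot_reparam hq.2 hf⟩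

/-- The diffeological subspace `Inj^∞(X, Y) ⊆ C^∞(X, Y)` of injective smooth maps. -/
abbrev InjSmoothMap (X Y : Type*) [DiffeologicalSpace X] [DiffeologicalSpace Y] : Type _ :=
  {f : DSmoothMap X Y // Function.Injective f}

/-! ### Topological notions with respect to the D-topology -/

/-- A set is D-open if it is open in the D-topology. -/
def IsDOpen {X : Type*} [DiffeologicalSpace X] (s : Set X) : Prop :=
  IsOpen[DiffeologicalSpace.dTopology] s

/-- A diffeological space is D-compact if it is compact in the D-topology. -/
def IsDCompact (X : Type*) [DiffeologicalSpace X] : Prop :=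
  @CompactSpace X DiffeologicalSpace.dTopology

/-- A diffeological space is D-Hausdorff if it is Hausdorff in the D-topology. -/
def IsDHausdorff (X : Type*) [DiffeologicalSpace X] : Prop :=
  @T2Space X DiffeologicalSpace.dTopology

/-- A D-embedding: a topological embedding with respect to the D-topologies. -/
def IsDEmbedding {X Y : Type*} [DiffeologicalSpace X] [DiffeologicalSpace Y]
    (f : X → Y) : Prop :=
  @Topology.IsEmbedding X Y DiffeologicalSpace.dTopology DiffeologicalSpace.dTopology f

/-! ### Classes of smooth maps -/

section Classes

variable {X Y : Type*} [DiffeologicalSpace X] [DiffeologicalSpace Y]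

/-- A diffeomorphism: a smooth map with a smooth two-sided inverse. -/
def IsDiffeomorphism (f : X → Y) : Prop :=
  DSmooth f ∧ ∃ g : Y → X, DSmooth g ∧ Function.LeftInverse g f ∧ Function.RightInverse g f

/-- The pullback `P^*X = {(r, x) | P r = f x}`, a subspace of the product. -/
abbrev DPullback {U : Type*} (P : U → Y) (f : X → Y) : Type _ :=
  {z : U × X // P z.1 = f z.2}

/-- The pullback `P^*f : P^*X → U` of `f` by `P`. -/
def DPullback.proj {U : Type*} (P : U → Y) (f : X → Y) (z : DPullback P f) : U := z.1.1

/-- A submersion: a smooth map with a smooth local section, defined on a D-open set, through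
every point of the source. -/
def IsDSubmersion (f : X → Y) : Prop :=
  DSmooth f ∧ ∀ x₀ : X, ∃ (O : Set Y) (σ : O → X), IsDOpen O ∧ DSmooth σ ∧
    (∀ y : O, f (σ y) = y) ∧ ∃ y₀ : O, σ y₀ = x₀

/-- A diffeological submersion: its pullback by every plot `P : U → Y` (with `U` open in some
`ℝⁿ`) is a submersion. -/
def IsDiffeologicalSubmersion (f : X → Y) : Prop :=
  DSmooth f ∧ ∀ (n : ℕ) (U : Set (EuclideanSpace ℝ (Fin n))), IsOpen U →
    ∀ P : U → Y, DSmooth P → IsDSubmersion (DPullback.proj P f)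

/-- A diffeological immersion: for every plot `P : U → Y` (with `U` open in some `ℝⁿ`) and every
`z₀` in `P^*X` there are a D-open neighbourhood `O` of `z₀`, an open neighbourhood `V ⊆ U` of
`P^*f(O)` and a smooth map `ϱ : V → U × X` with `ϱ (P^*f z) = z` for all `z` in `O`. -/
def IsDiffeologicalImmersion (f : X → Y) : Prop :=
  DSmooth f ∧ ∀ (n : ℕ) (U : Set (EuclideanSpace ℝ (Fin n))), IsOpen U →
    ∀ P : U → Y, DSmooth P → ∀ z₀ : DPullback P f,
      ∃ (O : Set (DPullback P f)) (V : Set U) (hV : Set.MapsTo (DPullback.proj P f) O V)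
        (ϱ : V → U × X), IsDOpen O ∧ z₀ ∈ O ∧ IsOpen V ∧ DSmooth ϱ ∧
        ∀ (z : DPullback P f) (hz : z ∈ O), ϱ ⟨DPullback.proj P f z, hV hz⟩ = z.1

/-- A diffeological embedding: a diffeological immersion that is a D-embedding. -/
def IsDiffeologicalEmbedding (f : X → Y) : Prop :=
  IsDiffeologicalImmersion f ∧ IsDEmbedding f

/-- An étale map: around every point it restricts to a diffeomorphism between D-open sets. -/
def IsDEtale (f : X → Y) : Prop :=
  ∀ x : X, ∃ (O : Set X) (O' : Set Y) (h : Set.MapsTo f O O'),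
    IsDOpen O ∧ x ∈ O ∧ IsDOpen O' ∧ IsDiffeomorphism (h.restrict f O O')

/-- A diffeological étale map: its pullback by every plot `P : U → Y` (with `U` open in some
`ℝⁿ`) is étale. -/
def IsDiffeologicalEtale (f : X → Y) : Prop :=
  DSmooth f ∧ ∀ (n : ℕ) (U : Set (EuclideanSpace ℝ (Fin n))), IsOpen U →
    ∀ P : U → Y, DSmooth P → IsDEtale (DPullback.proj P f)

/-- A local subduction: a smooth surjection such that every plot `P : U → Y` with
`P r₀ = f x` lifts along `f`, on an open neighbourhood of `r₀`, to a plot sending `r₀` to `x`. -/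
def IsLocalSubduction (f : X → Y) : Prop :=
  DSmooth f ∧ Function.Surjective f ∧
    ∀ (x : X) (n : ℕ) (U : Set (EuclideanSpace ℝ (Fin n))), IsOpen U →
      ∀ P : U → Y, DSmooth P → ∀ r₀ : U, P r₀ = f x →
        ∃ (V : Set U) (hr₀ : r₀ ∈ V) (Q : V → X), IsOpen V ∧ DSmooth Q ∧
          Q ⟨r₀, hr₀⟩ = x ∧ ∀ r : V, f (Q r) = P r

end Classes

/-! ### Étale manifolds and usual manifolds -/

/-- A diffeological étale `n`-manifold: there is an atlas `𝔄` of diffeological étale maps from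
open subsets of `ℝⁿ`, whose images cover the space. -/
def IsDiffeologicalEtaleManifoldOfDim (n : ℕ) (M : Type*) [DiffeologicalSpace M] : Prop :=
  ∃ 𝔄 : Set ((U : TopologicalSpace.Opens (EuclideanSpace ℝ (Fin n))) × (U → M)),
    (∀ φ ∈ 𝔄, IsDiffeologicalEtale φ.2) ∧ ∀ x : M, ∃ φ ∈ 𝔄, x ∈ Set.range φ.2

/-- A diffeological étale manifold: a diffeological étale `n`-manifold for some `n`. -/
def IsDiffeologicalEtaleManifold (M : Type*) [DiffeologicalSpace M] : Prop :=
  ∃ n : ℕ, IsDiffeologicalEtaleManifoldOfDim n M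

/-- A usual manifold: a second-countable Hausdorff smooth manifold of some finite dimension,
with the diffeology whose plots are the smooth maps in the sense of manifolds. -/
def IsUsualManifold (M : Type*) [DiffeologicalSpace M] : Prop :=
  ∃ (n : ℕ) (_ : TopologicalSpace M) (_ : ChartedSpace (EuclideanSpace ℝ (Fin n)) M),
    T2Space M ∧ SecondCountableTopology M ∧ IsManifold (𝓡 n) ∞ M ∧
      ∀ (k : ℕ) (p : EuclideanSpace ℝ (Fin k) → M), IsPlot p ↔ ContMDiff (𝓡 k) (𝓡 n) ∞ p

end

/-! D-openness is tested along plots `p` of the mapping space: a property of `p r₀` has to persist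
for `p r` with `r` near `r₀`.

Étale charts need not be injective, but plots lift locally through any prescribed preimage and the
germ of the lift is unique. So a smooth map has local representatives between open subsets of
Euclidean spaces, and by the inverse function theorem it is a diffeological submersion (immersion)
exactly when their derivatives are surjective (injective):
`IsDiffeologicalSubmersion.surjective_fderiv`, `isDiffeologicalSubmersion_of_hasLocalRepAt` and
their analogues for immersions. A plot of maps has representatives jointly smooth in parameter and
point. Surjectivity and injectivity are open conditions on the derivative, charts are D-open, and
D-compactness makes the neighbourhood of `r₀` uniform (`eventually_hasLocalRepAt`). Étale means
submersion and immersion.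

A local subduction is a surjective submersion. Surjectivity persists because the image of a nearby
map is clopen and still meets each of the finitely many components of `M`.

For a usual manifold `M`, injectivity of an immersion persists by compactness of `K × K`: off the
diagonal by separating images, near it by the derivative and the injectivity of the charts of `M`.
Finally, embeddings are injective immersions and diffeomorphisms are injective local subductions.
Inside `InjSmoothMap` injectivity is given, so only the openness of immersions and local subductions
remains. -/

/-! ### Plots on open subsets of finite-dimensional spaces -/

section PlotOn

variable {X Y : Type*} [DiffeologicalSpace X] [DiffeologicalSpace Y]
  {E E' : Type*} [NormedAddCommGroup E] [NormedSpace ℝ E]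
  [NormedAddCommGroup E'] [NormedSpace ℝ E']

/-- `g` is a plot on the set `S`: its composites with smooth maps into `S` are plots. -/
def PlotOn (g : E → X) (S : Set E) : Prop :=
  ∀ (k : ℕ) (q : EuclideanSpace ℝ (Fin k) → E), ContDiff ℝ ∞ q → (∀ t, q t ∈ S) → IsPlot (g ∘ q)

/-- Every open subset of a finite-dimensional space contains, around each of its points, the image
of a smooth map from a Euclidean space with a smooth local section. -/
theorem exists_contDiff_section [FiniteDimensional ℝ E] {S : Set E} (hS : IsOpen S) {r₀ : E}
    (hr₀ : r₀ ∈ S) : ∃ (k : ℕ) (c : EuclideanSpace ℝ (Fin k) → E)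
      (d : E → EuclideanSpace ℝ (Fin k)) (N : Set E), ContDiff ℝ ∞ c ∧ (∀ t, c t ∈ S) ∧
      IsOpen N ∧ r₀ ∈ N ∧ N ⊆ S ∧ ContDiffOn ℝ ∞ d N ∧ ∀ r ∈ N, c (d r) = r := by
  let g := toEuclidean (E := E)
  have hS' : IsOpen (g.symm ⁻¹' S) := hS.preimage g.symm.continuous
  obtain ⟨ε, hε, hb⟩ := Metric.isOpen_iff.1 hS' (g r₀) (by simpa using hr₀)
  -- Plots are defined on whole Euclidean spaces, so a ball inside the open set is parametrised by
  -- the whole space; `e.symm` gives the section.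
  let e := OpenPartialHomeomorph.univBall (g r₀) ε
  have he : e.target = Metric.ball (g r₀) ε := OpenPartialHomeomorph.univBall_target _ hε
  refine ⟨_, g.symm ∘ e, e.symm ∘ g, g ⁻¹' Metric.ball (g r₀) ε,
    g.symm.contDiff.comp OpenPartialHomeomorph.contDiff_univBall, fun t => ?_,
    Metric.isOpen_ball.preimage g.continuous, Metric.mem_ball_self hε, fun r hr => ?_, ?_,
    fun r hr => ?_⟩
  · apply hb
    rw [← he]
    exact e.map_source (by simp [e])
  · simpa using hb hr
  · exact (OpenPartialHomeomorph.contDiffOn_univBall_symm (c := g r₀) (r := ε)).comp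
      g.contDiff.contDiffOn fun r hr => hr
  · have : e (e.symm (g r)) = g r := e.right_inv (by rw [he]; exact hr)
    simp [this]

theorem PlotOn.mono {g : E → X} {S T : Set E} (hg : PlotOn g S) (h : T ⊆ S) : PlotOn g T :=
  fun k q hq hT => hg k q hq fun t => h (hT t)

theorem PlotOn.congr {g g' : E → X} {S : Set E} (hg : PlotOn g S) (h : ∀ r ∈ S, g' r = g r) :
    PlotOn g' S := fun k q hq hT => by
  have : g' ∘ q = g ∘ q := funext fun t => h _ (hT t)
  rw [this]
  exact hg k q hq hT

theorem PlotOn.dSmooth_comp {g : E → X} {S : Set E} {f : X → Y} (hf : DSmooth f)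
    (hg : PlotOn g S) : PlotOn (fun r => f (g r)) S :=
  fun k q hq hT => hf _ _ (hg k q hq hT)

/-- The composite of a plot on `S` with a smooth map into `S` is a plot. -/
theorem PlotOn.comp_contDiffOn {g : E → X} {S : Set E} (hg : PlotOn g S) {h : E' → E}
    {T : Set E'} (hh : ContDiffOn ℝ ∞ h T) (hST : Set.MapsTo h T S) :
    PlotOn (fun t => g (h t)) T := fun k q hq hqT =>
  hg k (h ∘ q) (contDiffOn_univ.1 (hh.comp hq.contDiffOn fun t _ => hqT t)) fun t => hST (hqT t)

theorem ContDiffOn.plotOn {n : ℕ} {g : E → EuclideanSpace ℝ (Fin n)} {S : Set E}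
    (hg : ContDiffOn ℝ ∞ g S) : PlotOn g S := fun _ q hq hT =>
  (contDiffOn_univ.1 (hg.comp hq.contDiffOn fun t _ => hT t) : ContDiff ℝ ∞ (g ∘ q)).isPlot

/-- Near each point `g = (g ∘ c) ∘ d`, where `g ∘ c` is a plot on a whole Euclidean space and `d` is
smooth. -/
theorem PlotOn.contDiffOn [FiniteDimensional ℝ E] {n : ℕ}
    {g : E → EuclideanSpace ℝ (Fin n)} {S : Set E} (hS : IsOpen S) (hg : PlotOn g S) :
    ContDiffOn ℝ ∞ g S := fun r hr => by
  obtain ⟨k, c, d, N, hc, hcS, hN, hrN, -, hd, hcd⟩ := exists_contDiff_section hS hr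
  have h1 : ContDiff ℝ ∞ (g ∘ c) := (hg k c hc hcS).contDiff
  have h2 : ContDiffOn ℝ ∞ g N :=
    (h1.comp_contDiffOn hd).congr fun r hr => by simp [hcd r hr]
  exact (h2.contDiffAt (hN.mem_nhds hrN)).contDiffWithinAt

theorem PlotOn.isOpen_inter_preimage [FiniteDimensional ℝ E] {g : E → X} {S : Set E}
    (hS : IsOpen S) (hg : PlotOn g S) {O : Set X} (hO : IsDOpen O) : IsOpen (S ∩ g ⁻¹' O) := by
  rw [isOpen_iff_mem_nhds]
  rintro r ⟨hr, hrO⟩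
  obtain ⟨k, c, d, N, hc, hcS, hN, hrN, hNS, hd, hcd⟩ := exists_contDiff_section hS hr
  have h1 := isOpen_iff_preimages_plots.1 hO k _ (hg k c hc hcS)
  have h2 := hd.continuousOn.isOpen_inter_preimage hN h1
  refine Filter.mem_of_superset (h2.mem_nhds ⟨hrN, by simpa [hcd r hrN] using hrO⟩) ?_
  rintro s ⟨hs, hs'⟩
  exact ⟨hNS hs, by simpa [hcd s hs] using hs'⟩

theorem PlotOn.eventually_mem [FiniteDimensional ℝ E] {g : E → X} {S : Set E}
    (hS : IsOpen S) (hg : PlotOn g S) {O : Set X} (hO : IsDOpen O) {r₀ : E} (hr₀ : r₀ ∈ S)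
    (h : g r₀ ∈ O) : ∀ᶠ r in 𝓝 r₀, g r ∈ O :=
  Filter.mem_of_superset ((hg.isOpen_inter_preimage hS hO).mem_nhds ⟨hr₀, h⟩) fun _ hs => hs.2

theorem PlotOn.dSmooth_restrict {n : ℕ} {U : Set (EuclideanSpace ℝ (Fin n))}
    {g : EuclideanSpace ℝ (Fin n) → X} (hg : PlotOn g U) : DSmooth (fun u : U => g u) :=
  fun k q hq => hg k (fun t => (q t : EuclideanSpace ℝ (Fin n))) (IsPlot.contDiff hq)
    fun t => (q t).2

/-- Extension of a function from a subset by a constant. -/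
noncomputable def extendConst {α β : Type*} {U : Set α} (P : U → β) (y : β) : α → β :=
  Function.extend Subtype.val P fun _ => y

@[simp]
theorem extendConst_coe {α β : Type*} {U : Set α} (P : U → β) (y : β) (u : U) :
    extendConst P y u = P u :=
  Subtype.val_injective.extend_apply _ _ _

theorem extendConst_of_mem {α β : Type*} {U : Set α} (P : U → β) (y : β) {u : α} (hu : u ∈ U) :
    extendConst P y u = P ⟨u, hu⟩ :=
  extendConst_coe P y ⟨u, hu⟩

theorem Diffeology.DSmooth.plotOn_extendConst {n : ℕ} {U : Set (EuclideanSpace ℝ (Fin n))} {P : U → X}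
    (hP : DSmooth P) (y : X) : PlotOn (extendConst P y) U := fun k q hq hT => by
  have : extendConst P y ∘ q = P ∘ fun t => ⟨q t, hT t⟩ := funext fun t => by
    simp [extendConst_of_mem P y (hT t)]
  rw [this]
  exact hP _ _ (show IsPlot q from hq.isPlot)

/-- The identity of the open set `U`, extended by a constant, is a plot on `U` and serves as the
test. With `isDOpen_of_isOpen`, the D-topology of `U` is the usual one. -/
theorem isOpen_of_isDOpen {n : ℕ} {U : Set (EuclideanSpace ℝ (Fin n))} (hU : IsOpen U)
    {O : Set U} (hO : IsDOpen O) : IsOpen O := by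
  rw [isOpen_iff_mem_nhds]
  intro u hu
  have h : PlotOn (extendConst (id : U → U) u) U := dSmooth_id.plotOn_extendConst u
  have h1 := h.eventually_mem hU hO u.2 (by simpa using hu)
  filter_upwards [continuous_subtype_val.continuousAt.eventually h1] with v hv
  simpa using hv

theorem isDOpen_of_isOpen {n : ℕ} {U : Set (EuclideanSpace ℝ (Fin n))} {O : Set U}
    (hO : IsOpen O) : IsDOpen O :=
  isOpen_iff_preimages_plots.2 fun _ p hp => hO.preimage
    (Continuous.subtype_mk (IsPlot.contDiff (X := EuclideanSpace ℝ (Fin n)) hp).continuous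
      fun t => (p t).2)

theorem isDOpen_preimage {f : X → Y} (hf : DSmooth f) {O : Set Y} (hO : IsDOpen O) :
    IsDOpen (f ⁻¹' O) :=
  isOpen_iff_preimages_plots.2 fun n p hp => isOpen_iff_preimages_plots.1 hO n _ (hf n p hp)

theorem IsDOpen.inter {s t : Set X} (hs : IsDOpen s) (ht : IsDOpen t) : IsDOpen (s ∩ t) :=
  @IsOpen.inter X DiffeologicalSpace.dTopology _ _ hs ht

theorem isDOpen_univ : IsDOpen (Set.univ : Set X) :=
  @isOpen_univ X DiffeologicalSpace.dTopology

theorem dSmooth_subtype_val {s : X → Prop} : DSmooth (Subtype.val : Subtype s → X) :=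
  fun _ _ hp => hp

theorem Diffeology.DSmooth.subtype_mk {s : Y → Prop} {f : X → Y} (hf : DSmooth f) (h : ∀ x, s (f x)) :
    DSmooth (fun x => (⟨f x, h x⟩ : Subtype s)) :=
  fun n p hp => hf n p hp

theorem dSmooth_fst : DSmooth (Prod.fst : X × Y → X) := fun _ _ hp => hp.1

theorem dSmooth_snd : DSmooth (Prod.snd : X × Y → Y) := fun _ _ hp => hp.2

theorem Diffeology.DSmooth.prodMk {Z : Type*} [DiffeologicalSpace Z] {f : X → Y} {g : X → Z}
    (hf : DSmooth f) (hg : DSmooth g) : DSmooth (fun x => (f x, g x)) :=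
  fun n p hp => ⟨hf n p hp, hg n p hp⟩

theorem dSmooth_proj {U Z : Type*} [DiffeologicalSpace U] (P : U → Z) (f : X → Z) :
    DSmooth (DPullback.proj P f) :=
  dSmooth_fst.comp dSmooth_subtype_val

end PlotOn

/-! ### Submersions, immersions and étale maps of diffeological spaces -/

section General

variable {X Y : Type*} [DiffeologicalSpace X] [DiffeologicalSpace Y] {f : X → Y}

/-- A lift `Q` of `P` through `x₀` amounts to the section `r ↦ (r, Q r)` of the pullback through
`(r₀, x₀)`. -/
theorem isDiffeologicalSubmersion_of_lift (hf : DSmooth f)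
    (h : ∀ (n : ℕ) (U : Set (EuclideanSpace ℝ (Fin n))), IsOpen U →
      ∀ P : EuclideanSpace ℝ (Fin n) → Y, PlotOn P U → ∀ r₀ ∈ U, ∀ x₀, P r₀ = f x₀ →
        ∃ (S : Set (EuclideanSpace ℝ (Fin n))) (Q : EuclideanSpace ℝ (Fin n) → X),
          IsOpen S ∧ r₀ ∈ S ∧ S ⊆ U ∧ PlotOn Q S ∧ Q r₀ = x₀ ∧ ∀ r ∈ S, f (Q r) = P r) :
    IsDiffeologicalSubmersion f := by
  refine ⟨hf, fun n U hU P hP => ⟨dSmooth_proj P f, ?_⟩⟩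
  rintro ⟨⟨r₀, x₀⟩, hz⟩
  have hz : P r₀ = f x₀ := hz
  obtain ⟨S, Q, hS, hr₀, hSU, hQ, hQ₀, hfQ⟩ := h n U hU (extendConst P (f x₀))
    (hP.plotOn_extendConst _) r₀ r₀.2 x₀ (by simpa using hz)
  have hmem : ∀ r : (Subtype.val ⁻¹' S : Set U), P r.1 = f (Q r.1.1) := fun r => by
    rw [hfQ _ r.2, extendConst_coe]
  refine ⟨Subtype.val ⁻¹' S, fun r => ⟨(r.1, Q r.1.1), hmem r⟩,
    isDOpen_of_isOpen (hS.preimage continuous_subtype_val), ?_, fun r => rfl,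
    ⟨r₀, hr₀⟩, Subtype.ext (Prod.ext rfl hQ₀)⟩
  intro k q hq
  exact ⟨hq, hQ k (fun t => (q t).1.1) (IsPlot.contDiff hq) fun t => (q t).2⟩

variable {E : Type*} [NormedAddCommGroup E] [NormedSpace ℝ E] [FiniteDimensional ℝ E]

/-- Plots lift locally, through any prescribed point, along diffeological submersions. -/
theorem IsDiffeologicalSubmersion.exists_lift (hf : IsDiffeologicalSubmersion f) {P : E → Y}
    {S : Set E} (hS : IsOpen S) (hP : PlotOn P S) {r₀ : E} (hr₀ : r₀ ∈ S) {x₀ : X}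
    (h : P r₀ = f x₀) : ∃ (T : Set E) (Q : E → X), IsOpen T ∧ r₀ ∈ T ∧ T ⊆ S ∧ PlotOn Q T ∧
      Q r₀ = x₀ ∧ ∀ r ∈ T, f (Q r) = P r := by
  obtain ⟨k, c, d, N, hc, hcS, hN, hrN, hNS, hd, hcd⟩ := exists_contDiff_section hS hr₀
  -- The definition concerns plots on open subsets of Euclidean spaces, so it is applied to `P ∘ c`
  -- and the section is carried back along `d`.
  have hPc : PlotOn (P ∘ c) Set.univ :=
    hP.comp_contDiffOn hc.contDiffOn fun t _ => hcS t
  obtain ⟨O, σ, hO, hσ, hσO, ⟨y₀, hy₀⟩, hσ₀⟩ :=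
    (hf.2 k Set.univ isOpen_univ _ hPc.dSmooth_restrict).2
      ⟨(⟨d r₀, trivial⟩, x₀), by simpa [hcd r₀ hrN] using h⟩
  have hy : y₀ = ⟨d r₀, trivial⟩ := by
    have := hσO ⟨y₀, hy₀⟩
    rw [hσ₀] at this
    exact this.symm
  subst hy
  have hO' : IsOpen (N ∩ d ⁻¹' (Subtype.val '' O)) :=
    hd.continuousOn.isOpen_inter_preimage hN
      (isOpen_univ.isOpenMap_subtype_val _ (isOpen_of_isDOpen isOpen_univ hO))
  have hmem : ∀ r ∈ N ∩ d ⁻¹' (Subtype.val '' O), (⟨d r, trivial⟩ : Set.univ) ∈ O := by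
    rintro r ⟨-, y, hy, hyr⟩
    have : y = ⟨d r, trivial⟩ := Subtype.ext hyr
    rwa [this] at hy
  classical
  refine ⟨_, fun r => if hr : (⟨d r, trivial⟩ : Set.univ) ∈ O then (σ ⟨_, hr⟩).1.2 else x₀,
    hO', ⟨hrN, _, hy₀, rfl⟩, fun r hr => hNS hr.1, ?_, ?_, fun r hr => ?_⟩
  · intro m q hq hqT
    have : IsPlot (fun t => σ ⟨⟨d (q t), trivial⟩, hmem _ (hqT t)⟩) :=
      hσ m (fun t => ⟨⟨d (q t), trivial⟩, hmem _ (hqT t)⟩)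
        (show IsPlot (d ∘ q) from (contDiffOn_univ.1
          (hd.comp hq.contDiffOn fun t _ => (hqT t).1) : ContDiff ℝ ∞ (d ∘ q)).isPlot)
    convert this.2 using 1
    funext t
    simp only [Function.comp, dif_pos (hmem _ (hqT t))]
  · simp only [dif_pos hy₀, hσ₀]
  · simp only [dif_pos (hmem r hr)]
    have h1 := (σ ⟨_, hmem r hr⟩).2
    have h2 : (σ ⟨_, hmem r hr⟩).1.1 = ⟨d r, trivial⟩ := hσO ⟨_, hmem r hr⟩
    rw [← h1, h2]
    simp [hcd r hr.1]

/-- A diffeological immersion has local retractions along plots. -/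
theorem IsDiffeologicalImmersion.exists_retraction (hf : IsDiffeologicalImmersion f) {P : E → Y}
    {S : Set E} (hS : IsOpen S) (hP : PlotOn P S) {r₀ : E} (hr₀ : r₀ ∈ S) {x₀ : X}
    (h : P r₀ = f x₀) : ∃ (T : Set E) (ρ : E → X), IsOpen T ∧ r₀ ∈ T ∧ T ⊆ S ∧ PlotOn ρ T ∧
      ρ r₀ = x₀ ∧
      ∀ {E' : Type} [NormedAddCommGroup E'] [NormedSpace ℝ E'] [FiniteDimensional ℝ E']
        {W : Set E'} {a : E' → E} {b : E' → X} {t₀ : E'}, IsOpen W → t₀ ∈ W →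
        ContDiffOn ℝ ∞ a W → PlotOn b W → (∀ t ∈ W, P (a t) = f (b t)) → a t₀ = r₀ → b t₀ = x₀ →
        ∀ᶠ t in 𝓝 t₀, ρ (a t) = b t := by
  obtain ⟨k, c, d, N, hc, hcS, hN, hrN, hNS, hd, hcd⟩ := exists_contDiff_section hS hr₀
  have hPc : PlotOn (P ∘ c) Set.univ :=
    hP.comp_contDiffOn hc.contDiffOn fun t _ => hcS t
  let P' : ↥(Set.univ : Set (EuclideanSpace ℝ (Fin k))) → Y := fun u => (P ∘ c) u
  let z₀ : DPullback P' f := ⟨(⟨d r₀, trivial⟩, x₀), by simpa [P', hcd r₀ hrN] using h⟩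
  obtain ⟨O, V, hOV, ϱ, hO, hzO, hV, hϱ, hϱz⟩ :=
    hf.2 k Set.univ isOpen_univ P' hPc.dSmooth_restrict z₀
  have hT : IsOpen (N ∩ d ⁻¹' (Subtype.val '' V)) :=
    hd.continuousOn.isOpen_inter_preimage hN (isOpen_univ.isOpenMap_subtype_val _ hV)
  have hmem : ∀ r ∈ N ∩ d ⁻¹' (Subtype.val '' V), (⟨d r, trivial⟩ : Set.univ) ∈ V := by
    rintro r ⟨-, y, hy, hyr⟩
    have : y = ⟨d r, trivial⟩ := Subtype.ext hyr
    rwa [this] at hy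
  have hz₀V : (⟨d r₀, trivial⟩ : Set.univ) ∈ V := hOV hzO
  classical
  refine ⟨_, fun r => if hr : (⟨d r, trivial⟩ : Set.univ) ∈ V then (ϱ ⟨_, hr⟩).2 else x₀,
    hT, ⟨hrN, _, hz₀V, rfl⟩, fun r hr => hNS hr.1, ?_, ?_, ?_⟩
  · intro m q hq hqT
    have : IsPlot (fun t => ϱ ⟨⟨d (q t), trivial⟩, hmem _ (hqT t)⟩) :=
      hϱ m (fun t => ⟨⟨d (q t), trivial⟩, hmem _ (hqT t)⟩)
        (show IsPlot (d ∘ q) from (contDiffOn_univ.1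
          (hd.comp hq.contDiffOn fun t _ => (hqT t).1) : ContDiff ℝ ∞ (d ∘ q)).isPlot)
    convert this.2 using 1
    funext t
    simp only [Function.comp, dif_pos (hmem _ (hqT t))]
  · have := hϱz z₀ hzO
    simp only [dif_pos hz₀V]
    exact congrArg Prod.snd this
  · intro E' _ _ _ W a b t₀ hW ht₀ ha hb hab hat hbt
    have hW' : IsOpen (W ∩ a ⁻¹' N) := ha.continuousOn.isOpen_inter_preimage hW hN
    have ht₀' : t₀ ∈ W ∩ a ⁻¹' N := ⟨ht₀, by simpa [hat] using hrN⟩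
    have hmem' : ∀ t ∈ W ∩ a ⁻¹' N, P' ⟨d (a t), trivial⟩ = f (b t) := fun t ht => by
      simp [P', hcd _ ht.2, hab t ht.1]
    -- Near `t₀` the pair `(d ∘ a, b)` is a plot of the pullback through `z₀`, so it stays in the
    -- D-open set `O`, where `ϱ` inverts the projection.
    let z : E' → DPullback P' f := fun t =>
      if ht : t ∈ W ∩ a ⁻¹' N then ⟨(⟨d (a t), trivial⟩, b t), hmem' t ht⟩ else z₀
    have hzp : PlotOn z (W ∩ a ⁻¹' N) := by
      intro m q hq hqT
      have h1 : (fun t => (z (q t)).1) = fun t => (⟨d (a (q t)), trivial⟩, b (q t)) := by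
        funext t
        simp only [z, dif_pos (hqT t)]
      have h2 : IsPlot (fun t => (z (q t)).1) := by
        rw [h1]
        refine ⟨?_, hb m q hq fun t => (hqT t).1⟩
        exact (contDiffOn_univ.1 ((hd.comp (ha.mono Set.inter_subset_left)
          fun t ht => ht.2).comp hq.contDiffOn fun t _ => hqT t) :
            ContDiff ℝ ∞ (fun t => d (a (q t)))).isPlot
      exact h2
    have hz0 : z t₀ = z₀ := by
      simp only [z, dif_pos ht₀', z₀, hat, hbt]
    filter_upwards [hzp.eventually_mem hW' hO ht₀' (by rwa [hz0]), hW'.mem_nhds ht₀']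
      with t htO htW
    have h1 := hϱz (z t) htO
    have h2 : (z t).1 = (⟨d (a t), trivial⟩, b t) := by simp only [z, dif_pos htW]
    have h3 : DPullback.proj P' f (z t) = ⟨d (a t), trivial⟩ := congrArg Prod.fst h2
    have h4 : (⟨d (a t), trivial⟩ : Set.univ) ∈ V := by rw [← h3]; exact hOV htO
    simp only [dif_pos h4]
    have h5 : (ϱ ⟨⟨d (a t), trivial⟩, h4⟩) = (z t).1 := by
      rw [← h1]
      congr 1
      exact Subtype.ext h3.symm
    rw [h5, h2]

/-- Local lifts along diffeological immersions are unique. -/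
theorem IsDiffeologicalImmersion.eventually_eq (hf : IsDiffeologicalImmersion f)
    {E : Type} [NormedAddCommGroup E] [NormedSpace ℝ E] [FiniteDimensional ℝ E] {S : Set E}
    {a b : E → X} {r₀ : E} (hS : IsOpen S) (hr₀ : r₀ ∈ S) (ha : PlotOn a S) (hb : PlotOn b S)
    (hab : ∀ r ∈ S, f (a r) = f (b r)) (h₀ : a r₀ = b r₀) : ∀ᶠ r in 𝓝 r₀, a r = b r := by
  -- Both `a` and `b` lift the plot `f ∘ a` through the same point, so its retraction equals each of
  -- them near `r₀`.
  obtain ⟨T, ρ, -, -, -, -, -, h⟩ :=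
    hf.exists_retraction hS (PlotOn.dSmooth_comp hf.1 ha) hr₀ (x₀ := a r₀) rfl
  filter_upwards [h hS hr₀ contDiffOn_id ha (fun _ _ => rfl) rfl rfl,
    h hS hr₀ contDiffOn_id hb hab rfl h₀.symm] with r h1 h2
  exact h1.symm.trans h2

theorem IsDiffeologicalEtale.isDiffeologicalSubmersion (hf : IsDiffeologicalEtale f) :
    IsDiffeologicalSubmersion f := by
  refine ⟨hf.1, fun n U hU P hP => ⟨dSmooth_proj P f, fun z₀ => ?_⟩⟩
  obtain ⟨O, O', h, hO, hz, hO', -, g, hg, hl, hr⟩ := hf.2 n U hU P hP z₀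
  exact ⟨O', fun r => (g r).1, hO', dSmooth_subtype_val.comp hg,
    fun r => congrArg Subtype.val (hr r), ⟨_, h hz⟩, congrArg Subtype.val (hl ⟨z₀, hz⟩)⟩

theorem IsDiffeologicalEtale.isDiffeologicalImmersion (hf : IsDiffeologicalEtale f) :
    IsDiffeologicalImmersion f := by
  refine ⟨hf.1, fun n U hU P hP z₀ => ?_⟩
  obtain ⟨O, O', h, hO, hz, hO', -, g, hg, hl, hr⟩ := hf.2 n U hU P hP z₀
  exact ⟨O, O', h, fun r => (g r).1.1, hO, hz, isOpen_of_isDOpen hU hO',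
    dSmooth_subtype_val.comp (dSmooth_subtype_val.comp hg),
    fun z hz => congrArg (fun w => w.1.1) (hl ⟨z, hz⟩)⟩

/-- The submersion gives a section `σ` of the projection, the immersion a D-open `O` on which the
projection is injective. Over the base points that `σ` sends into `O`, the two are mutually inverse.
-/
theorem isDiffeologicalEtale_iff : IsDiffeologicalEtale f ↔
    IsDiffeologicalSubmersion f ∧ IsDiffeologicalImmersion f := by
  refine ⟨fun h => ⟨h.isDiffeologicalSubmersion, h.isDiffeologicalImmersion⟩,
    fun ⟨hs, hi⟩ => ⟨hs.1, fun n U hU P hP z₀ => ?_⟩⟩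
  obtain ⟨O₁, σ, hO₁, hσ, hσO, y₀, hy₀⟩ := (hs.2 n U hU P hP).2 z₀
  obtain ⟨O, V, hOV, ϱ, hO, hzO, hV, hϱ, hϱz⟩ := hi.2 n U hU P hP z₀
  have hinj : ∀ z ∈ O, ∀ w ∈ O, DPullback.proj P f z = DPullback.proj P f w → z = w := by
    intro z hz w hw hzw
    apply Subtype.ext
    rw [← hϱz z hz, ← hϱz w hw]
    congr 1
    exact Subtype.ext hzw
  -- `σ ⁻¹' O` is D-open in the subspace `O₁`. Since `O₁` is itself D-open, plots of the base
  -- corestrict locally to `O₁`, so the image is D-open in the base.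
  have hW : IsDOpen (Subtype.val '' (σ ⁻¹' O)) := by
    refine isOpen_iff_preimages_plots.2 fun m p hp => isOpen_iff_mem_nhds.2 ?_
    rintro t ⟨y, hy, hyt⟩
    have h1 : IsOpen (p ⁻¹' O₁) := isOpen_iff_preimages_plots.1 hO₁ m p hp
    have ht : t ∈ p ⁻¹' O₁ := by simp [← hyt]
    classical
    let q : EuclideanSpace ℝ (Fin m) → O₁ := fun s => if hs : p s ∈ O₁ then ⟨p s, hs⟩ else y
    have hq : PlotOn q (p ⁻¹' O₁) := by
      intro k c hc hcT
      have : (fun s => (q (c s)).1) = p ∘ c := funext fun s => by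
        have hs : p (c s) ∈ O₁ := hcT s
        simp only [q, dif_pos hs, Function.comp]
      show IsPlot (fun s => (q (c s)).1)
      rw [this]
      exact isPlot_reparam hp hc
    have hqt : q t = y := by
      have ht' : p t ∈ O₁ := ht
      simp only [q, dif_pos ht']
      exact Subtype.ext hyt.symm
    filter_upwards [hq.eventually_mem h1 (isDOpen_preimage hσ hO) ht (by rwa [hqt]),
      h1.mem_nhds ht] with s hs hs'
    have hs'' : p s ∈ O₁ := hs'
    exact ⟨q s, hs, by simp only [q, dif_pos hs'']⟩
  have hmem : ∀ r ∈ Subtype.val '' (σ ⁻¹' O), r ∈ O₁ := by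
    rintro _ ⟨y, -, rfl⟩
    exact y.2
  have hmem' : ∀ r (hr : r ∈ Subtype.val '' (σ ⁻¹' O)), σ ⟨r, hmem r hr⟩ ∈ O := by
    rintro _ ⟨y, hy, rfl⟩
    exact hy
  refine ⟨O ∩ DPullback.proj P f ⁻¹' (Subtype.val '' (σ ⁻¹' O)), Subtype.val '' (σ ⁻¹' O),
    fun z hz => hz.2, hO.inter (isDOpen_preimage (dSmooth_proj P f) hW), ⟨hzO, y₀, ?_, ?_⟩, hW,
    ?_, fun r => ⟨σ ⟨r, hmem r r.2⟩, hmem' r r.2, ?_⟩, ?_, ?_, ?_⟩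
  · simpa [hy₀] using hzO
  · rw [← hσO y₀, hy₀]
  · exact ((dSmooth_proj P f).comp dSmooth_subtype_val).subtype_mk _
  · simp only [Set.mem_preimage, hσO]
    exact r.2
  · have : DSmooth fun r : ↥(Subtype.val '' (σ ⁻¹' O)) => (⟨r.1, hmem r r.2⟩ : O₁) :=
      dSmooth_subtype_val.subtype_mk _
    exact (hσ.comp this).subtype_mk _
  · rintro ⟨z, hz, hz'⟩
    exact Subtype.ext (hinj _ (hmem' _ hz') _ hz (hσO _))
  · intro r
    exact Subtype.ext (hσO _)

theorem IsLocalSubduction.isDiffeologicalSubmersion (hf : IsLocalSubduction f) :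
    IsDiffeologicalSubmersion f := by
  refine ⟨hf.1, fun n U hU P hP => ⟨dSmooth_proj P f, ?_⟩⟩
  rintro ⟨⟨r₀, x₀⟩, hz⟩
  obtain ⟨V, hr₀, Q, hV, hQ, hQ₀, hfQ⟩ := hf.2.2 x₀ n U hU P hP r₀ hz
  exact ⟨V, fun r => ⟨(r.1, Q r), (hfQ r).symm⟩, isDOpen_of_isOpen hV,
    (dSmooth_subtype_val.prodMk hQ).subtype_mk _, fun r => rfl, ⟨r₀, hr₀⟩,
    Subtype.ext (Prod.ext rfl hQ₀)⟩

theorem isLocalSubduction_iff : IsLocalSubduction f ↔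
    Function.Surjective f ∧ IsDiffeologicalSubmersion f := by
  refine ⟨fun h => ⟨h.2.1, h.isDiffeologicalSubmersion⟩, fun ⟨hs, hf⟩ => ⟨hf.1, hs, ?_⟩⟩
  intro x n U hU P hP r₀ hr₀
  obtain ⟨O, σ, hO, hσ, hσO, y₀, hy₀⟩ := (hf.2 n U hU P hP).2 ⟨(r₀, x), hr₀⟩
  have hy : y₀.1 = r₀ := by
    rw [← hσO y₀, hy₀]
    rfl
  have hr₀O : r₀ ∈ O := hy ▸ y₀.2
  have hy' : y₀ = ⟨r₀, hr₀O⟩ := Subtype.ext hy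
  subst hy'
  refine ⟨O, hr₀O, fun r => (σ r).1.2, isOpen_of_isDOpen hU hO,
    dSmooth_snd.comp (dSmooth_subtype_val.comp hσ), by simp only [hy₀], fun r => ?_⟩
  rw [← (σ r).2]
  exact congrArg P (hσO r)

theorem IsDiffeomorphism.isDiffeologicalImmersion (hf : IsDiffeomorphism f) :
    IsDiffeologicalImmersion f := by
  obtain ⟨hf, g, hg, hl, -⟩ := hf
  refine ⟨hf, fun n U hU P hP z₀ => ⟨Set.univ, Set.univ, fun _ _ => trivial,
    fun r => (r.1, g (P r.1)), isDOpen_univ, trivial, isOpen_univ,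
    dSmooth_subtype_val.prodMk (hg.comp (hP.comp dSmooth_subtype_val)), fun z _ => ?_⟩⟩
  refine Prod.ext rfl ?_
  show g (P z.1.1) = z.1.2
  rw [z.2, hl]

/-- Lifts along an injective map are unique, so the set-theoretic inverse of a plot agrees locally
with a smooth lift and is therefore a plot. -/
theorem isDiffeomorphism_iff : IsDiffeomorphism f ↔
    Function.Injective f ∧ IsLocalSubduction f := by
  constructor
  · rintro ⟨hf, g, hg, hl, hr⟩
    refine ⟨hl.injective, hf, hr.surjective, fun x n U hU P hP r₀ hr₀ => ?_⟩
    exact ⟨Set.univ, trivial, fun r => g (P r.1), isOpen_univ,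
      hg.comp (hP.comp dSmooth_subtype_val), by simp only [hr₀, hl x], fun r => hr _⟩
  · rintro ⟨hi, hf⟩
    obtain ⟨g, hg⟩ := hf.2.1.hasRightInverse
    refine ⟨hf.1, g, fun n p hp => DiffeologicalSpace.locality fun r₀ => ?_,
      fun x => hi (hg (f x)), hg⟩
    obtain ⟨T, Q, hT, hr₀, -, hQ, -, hfQ⟩ := hf.isDiffeologicalSubmersion.exists_lift
      (P := p) isOpen_univ (fun k q hq _ => isPlot_reparam hp hq) (Set.mem_univ r₀)
      (x₀ := g (p r₀)) (hg _).symm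
    refine ⟨T, hT, hr₀, fun {m q} hq hqs => ?_⟩
    have : g ∘ p ∘ q = Q ∘ q := funext fun t => hi (by
      simp only [Function.comp, hg _, hfQ _ (hq t)])
    have h := hQ m q hqs hq
    rw [← this] at h
    exact h

/-- Diffeological submersions are D-open maps. -/
theorem IsDiffeologicalSubmersion.isDOpen_image (hf : IsDiffeologicalSubmersion f) {O : Set X}
    (hO : IsDOpen O) : IsDOpen (f '' O) := by
  refine isOpen_iff_preimages_plots.2 fun n p hp => isOpen_iff_mem_nhds.2 ?_
  rintro r₀ ⟨x₀, hx₀, h⟩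
  obtain ⟨T, Q, hT, hr₀, -, hQ, hQ₀, hfQ⟩ := hf.exists_lift
    (P := p) isOpen_univ (fun k q hq _ => isPlot_reparam hp hq) (Set.mem_univ r₀) h.symm
  filter_upwards [hQ.eventually_mem hT hO hr₀ (by rwa [hQ₀]), hT.mem_nhds hr₀] with r hr hr'
  exact ⟨Q r, hr, hfQ r hr'⟩

end General

/-! ### Smooth maps with surjective or injective derivative -/

section Calculus

variable {E E' : Type*} [NormedAddCommGroup E] [NormedSpace ℝ E]
  [NormedAddCommGroup E'] [NormedSpace ℝ E']

/-- Inverse function theorem for a map whose derivative at `u₀` is the identity. -/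
theorem exists_contDiffOn_inverse [FiniteDimensional ℝ E] {G : E → E} {T : Set E} (hT : IsOpen T)
    (hG : ContDiffOn ℝ ∞ G T) {u₀ : E} (hu₀ : u₀ ∈ T)
    (hd : HasFDerivAt G (ContinuousLinearMap.id ℝ E) u₀) :
    ∃ (S : Set E) (s : E → E), IsOpen S ∧ G u₀ ∈ S ∧ ContDiffOn ℝ ∞ s S ∧ Set.MapsTo s S T ∧
      s (G u₀) = u₀ ∧ (∀ v ∈ S, G (s v) = v) ∧ ∀ᶠ u in 𝓝 u₀, s (G u) = u := by
  have : CompleteSpace E := FiniteDimensional.complete ℝ E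
  have hat : ∀ u ∈ T, ContDiffAt ℝ ∞ G u := fun u hu => hG.contDiffAt (hT.mem_nhds hu)
  have hn : (∞ : WithTop ℕ∞) ≠ 0 := by simp
  have hd' : HasFDerivAt G ((ContinuousLinearEquiv.refl ℝ E : E ≃L[ℝ] E) : E →L[ℝ] E) u₀ := hd
  let e := (hat u₀ hu₀).toOpenPartialHomeomorph G hd' hn
  have he : ∀ u, e u = G u := fun u => rfl
  have hu₀e : u₀ ∈ e.source := (hat u₀ hu₀).mem_toOpenPartialHomeomorph_source hd' hn
  -- The inverse is known to be smooth only at points where the derivative is invertible, an open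
  -- condition to which the target is cut down.
  have hR : IsOpen (T ∩ fderiv ℝ G ⁻¹' Set.range ((↑) : (E ≃L[ℝ] E) → E →L[ℝ] E)) :=
    (hG.continuousOn_fderiv_of_isOpen hT (by simp)).isOpen_inter_preimage hT
      (ContinuousLinearEquiv.isOpen)
  have hS := e.symm.continuousOn.isOpen_inter_preimage e.symm.open_source hR
  have hsym : e.symm (G u₀) = u₀ := e.left_inv hu₀e
  refine ⟨_, e.symm, hS, ⟨e.map_source hu₀e, ?_⟩, fun v hv => ?_, fun v hv => hv.2.1, hsym,
    fun v hv => e.right_inv hv.1, ?_⟩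
  · simp only [Set.mem_preimage, hsym]
    exact ⟨hu₀, ContinuousLinearEquiv.refl ℝ E, hd'.fderiv.symm⟩
  · obtain ⟨hv, hvT, A, hA⟩ := hv
    refine (e.contDiffAt_symm (f₀' := A) hv ?_ (hat _ hvT)).contDiffWithinAt
    rw [hA]
    exact ((hat _ hvT).differentiableAt hn).hasFDerivAt
  · filter_upwards [e.open_source.mem_nhds hu₀e] with u hu
    exact e.left_inv hu

/-- A smooth map with surjective derivative has a smooth local section. -/
theorem exists_contDiffOn_section_of_surjective [FiniteDimensional ℝ E'] {F : E → E'}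
    {T : Set E} (hT : IsOpen T) (hF : ContDiffOn ℝ ∞ F T) {u₀ : E} (hu₀ : u₀ ∈ T)
    (hd : Function.Surjective (fderiv ℝ F u₀)) :
    ∃ (S : Set E') (s : E' → E), IsOpen S ∧ F u₀ ∈ S ∧ ContDiffOn ℝ ∞ s S ∧ Set.MapsTo s S T ∧
      s (F u₀) = u₀ ∧ ∀ v ∈ S, F (s v) = v := by
  obtain ⟨B, hB⟩ := (fderiv ℝ F u₀).exists_rightInverse_of_surjective
    (LinearMap.range_eq_top.2 hd)
  -- An affine slice through `u₀` along a right inverse `B` of the derivative: `F ∘ j` has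
  -- derivative the identity at `F u₀`.
  let j : E' → E := fun v => u₀ + B (v - F u₀)
  have hj : ContDiff ℝ ∞ j := by fun_prop
  have hj₀ : j (F u₀) = u₀ := by simp [j]
  have hjd : HasFDerivAt j B (F u₀) :=
    (B.hasFDerivAt.comp (F u₀) ((hasFDerivAt_id _).sub_const _)).const_add u₀
  have hFd : HasFDerivAt F (fderiv ℝ F u₀) (j (F u₀)) := by
    rw [hj₀]
    exact ((hF.contDiffAt (hT.mem_nhds hu₀)).differentiableAt (by simp)).hasFDerivAt
  have hGd := hFd.comp (F u₀) hjd
  rw [hB] at hGd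
  obtain ⟨S, s, hS, hmem, hs, hsT, hs₀, hGs, -⟩ := exists_contDiffOn_inverse
    (hT.preimage hj.continuous) (hF.comp hj.contDiffOn fun v hv => hv)
    (u₀ := F u₀) (by simpa [hj₀] using hu₀) hGd
  simp only [Function.comp, hj₀] at hmem hs₀ hGs
  exact ⟨S, j ∘ s, hS, hmem, hj.comp_contDiffOn hs, fun v hv => hsT hv, by simp [hs₀, hj₀], hGs⟩

/-- A smooth map with injective derivative has a smooth local retraction. -/
theorem exists_contDiffOn_retraction_of_injective [FiniteDimensional ℝ E]
    [FiniteDimensional ℝ E'] {F : E → E'} {T : Set E} (hT : IsOpen T) (hF : ContDiffOn ℝ ∞ F T) {u₀ : E} (hu₀ : u₀ ∈ T)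
    (hd : Function.Injective (fderiv ℝ F u₀)) :
    ∃ (S : Set E') (s : E' → E), IsOpen S ∧ F u₀ ∈ S ∧ ContDiffOn ℝ ∞ s S ∧ Set.MapsTo s S T ∧
      s (F u₀) = u₀ ∧ ∀ᶠ u in 𝓝 u₀, s (F u) = u := by
  obtain ⟨C₀, hC₀⟩ := (fderiv ℝ F u₀ : E →ₗ[ℝ] E').exists_leftInverse_of_injective
    (LinearMap.ker_eq_bot.2 hd)
  let C : E' →L[ℝ] E := LinearMap.toContinuousLinearMap C₀
  have hC : C.comp (fderiv ℝ F u₀) = ContinuousLinearMap.id ℝ E := by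
    ext x
    exact LinearMap.congr_fun hC₀ x
  have hFd : HasFDerivAt F (fderiv ℝ F u₀) u₀ :=
    ((hF.contDiffAt (hT.mem_nhds hu₀)).differentiableAt (by simp)).hasFDerivAt
  -- With `C` a left inverse of the derivative, `C ∘ F` has derivative the identity; its local
  -- inverse after `C` is the retraction.
  have hGd := C.hasFDerivAt.comp u₀ hFd
  rw [hC] at hGd
  obtain ⟨S, s, hS, hmem, hs, hsT, hs₀, -, hsG⟩ := exists_contDiffOn_inverse
    hT (C.contDiff.comp_contDiffOn hF) hu₀ hGd
  exact ⟨C ⁻¹' S, s ∘ C, hS.preimage C.continuous, hmem,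
    hs.comp C.contDiff.contDiffOn fun v hv => hv, fun v hv => hsT hv, hs₀, hsG⟩

/-- If `B` is a right inverse of `A`, then `A' ∘ B` is near the identity, hence invertible, for `A'`
near `A`. The injective case uses a left inverse in the same way. -/
theorem eventually_surjective [FiniteDimensional ℝ E'] {A : E →L[ℝ] E'} (hA : Function.Surjective A) :
    ∀ᶠ A' : E →L[ℝ] E' in 𝓝 A, Function.Surjective A' := by
  obtain ⟨B, hB⟩ := A.exists_rightInverse_of_surjective (LinearMap.range_eq_top.2 hA)
  have hc : Continuous fun A' : E →L[ℝ] E' => A'.comp B := by fun_prop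
  have ho := (ContinuousLinearEquiv.isOpen (𝕜 := ℝ) (E := E') (F := E')).preimage hc
  filter_upwards [ho.mem_nhds ⟨ContinuousLinearEquiv.refl ℝ E', hB.symm⟩]
  rintro A' ⟨e, he⟩ y
  refine ⟨B (e.symm y), ?_⟩
  have := congrArg (fun L : E' →L[ℝ] E' => L (e.symm y)) he
  simpa using this.symm

theorem eventually_injective [FiniteDimensional ℝ E] [FiniteDimensional ℝ E'] {A : E →L[ℝ] E'}
    (hA : Function.Injective A) :
    ∀ᶠ A' : E →L[ℝ] E' in 𝓝 A, Function.Injective A' := by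
  obtain ⟨C₀, hC₀⟩ := (A : E →ₗ[ℝ] E').exists_leftInverse_of_injective
    (LinearMap.ker_eq_bot.2 hA)
  let C : E' →L[ℝ] E := LinearMap.toContinuousLinearMap C₀
  have hC : C.comp A = ContinuousLinearMap.id ℝ E := by
    ext x
    exact LinearMap.congr_fun hC₀ x
  have hc : Continuous fun A' : E →L[ℝ] E' => C.comp A' := by fun_prop
  have ho := (ContinuousLinearEquiv.isOpen (𝕜 := ℝ) (E := E) (F := E)).preimage hc
  filter_upwards [ho.mem_nhds ⟨ContinuousLinearEquiv.refl ℝ E, hC.symm⟩]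
  rintro A' ⟨e, he⟩ x y hxy
  apply e.injective
  have h : ∀ z, e z = C (A' z) := fun z => congrArg (fun L : E →L[ℝ] E => L z) he
  rw [h, h, hxy]

end Calculus

/-! ### Étale charts -/

section Charts

variable {X Y : Type*} [DiffeologicalSpace X] [DiffeologicalSpace Y]

/-- `φ` restricts to a diffeological étale map on the open set `U`. -/
def IsEtaleChart {n : ℕ} (U : Set (EuclideanSpace ℝ (Fin n)))
    (φ : EuclideanSpace ℝ (Fin n) → X) : Prop :=
  IsOpen U ∧ IsDiffeologicalEtale (fun u : U => φ u)

theorem IsDiffeologicalEtaleManifold.exists_isEtaleChart (hX : IsDiffeologicalEtaleManifold X) :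
    ∃ n : ℕ, ∀ x : X, ∃ (U : Set (EuclideanSpace ℝ (Fin n)))
      (φ : EuclideanSpace ℝ (Fin n) → X), ∃ u ∈ U, IsEtaleChart U φ ∧ φ u = x := by
  obtain ⟨n, 𝔄, h𝔄, hc⟩ := hX
  refine ⟨n, fun x => ?_⟩
  obtain ⟨⟨U, φ⟩, hφ, u, hu⟩ := hc x
  refine ⟨U, extendConst φ x, u, u.2, ⟨U.isOpen, ?_⟩, ?_⟩
  · have : (fun u : (U : Set (EuclideanSpace ℝ (Fin n))) => extendConst φ x u) = φ :=
      funext fun u => extendConst_coe φ x u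
    rw [this]
    exact h𝔄 _ hφ
  · rw [← hu]
    exact extendConst_coe φ _ u

variable {n : ℕ} {U : Set (EuclideanSpace ℝ (Fin n))} {φ : EuclideanSpace ℝ (Fin n) → X}
  {E : Type} [NormedAddCommGroup E] [NormedSpace ℝ E] [FiniteDimensional ℝ E]

theorem IsEtaleChart.plotOn (hφ : IsEtaleChart U φ) : PlotOn φ U := fun k q hq hT =>
  hφ.2.1 k (fun t => ⟨q t, hT t⟩) (show IsPlot q from hq.isPlot)

/-- Replaces the inverse of a chart: any preimage `u₀` of the base value may be prescribed. -/
theorem IsEtaleChart.exists_lift (hφ : IsEtaleChart U φ) {P : E → X} {S : Set E}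
    (hS : IsOpen S) (hP : PlotOn P S) {r₀ : E} (hr₀ : r₀ ∈ S)
    {u₀ : EuclideanSpace ℝ (Fin n)} (hu₀ : u₀ ∈ U) (h : P r₀ = φ u₀) :
    ∃ (T : Set E) (Q : E → EuclideanSpace ℝ (Fin n)), IsOpen T ∧ r₀ ∈ T ∧ T ⊆ S ∧
      ContDiffOn ℝ ∞ Q T ∧ Set.MapsTo Q T U ∧ Q r₀ = u₀ ∧ ∀ r ∈ T, φ (Q r) = P r := by
  obtain ⟨T, Q, hT, hr₀, hTS, hQ, hQ₀, hQP⟩ :=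
    hφ.2.isDiffeologicalSubmersion.exists_lift hS hP hr₀ (x₀ := ⟨u₀, hu₀⟩) h
  exact ⟨T, fun r => Q r, hT, hr₀, hTS,
    (PlotOn.dSmooth_comp dSmooth_subtype_val hQ).contDiffOn hT, fun r _ => (Q r).2,
    congrArg Subtype.val hQ₀, hQP⟩

/-- Replaces injectivity of a chart: charts are immersions, so two lifts agreeing at one point agree
near it. -/
theorem IsEtaleChart.eventually_eq (hφ : IsEtaleChart U φ) {S : Set E} (hS : IsOpen S) {r₀ : E}
    (hr₀ : r₀ ∈ S) {a b : E → EuclideanSpace ℝ (Fin n)} (ha : ContDiffOn ℝ ∞ a S)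
    (hb : ContDiffOn ℝ ∞ b S) (haU : Set.MapsTo a S U) (hbU : Set.MapsTo b S U)
    (hab : ∀ r ∈ S, φ (a r) = φ (b r)) (h₀ : a r₀ = b r₀) : ∀ᶠ r in 𝓝 r₀, a r = b r := by
  have key : ∀ c : E → EuclideanSpace ℝ (Fin n), ContDiffOn ℝ ∞ c S → Set.MapsTo c S U →
      ∃ c' : E → U, PlotOn c' S ∧ ∀ r ∈ S, (c' r : EuclideanSpace ℝ (Fin n)) = c r := by
    intro c hc hcU
    classical
    refine ⟨fun r => if h : c r ∈ U then ⟨c r, h⟩ else ⟨c r₀, hcU hr₀⟩, ?_, ?_⟩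
    · intro k q hq hqS
      refine (?_ : PlotOn (fun r => ((if h : c r ∈ U then ⟨c r, h⟩ else ⟨c r₀, hcU hr₀⟩ : U) :
        EuclideanSpace ℝ (Fin n))) S) k q hq hqS
      exact hc.plotOn.congr fun r hr => by simp [dif_pos (hcU hr)]
    · intro r hr
      simp [dif_pos (hcU hr)]
  obtain ⟨a', ha', haa⟩ := key a ha haU
  obtain ⟨b', hb', hbb⟩ := key b hb hbU
  have := hφ.2.isDiffeologicalImmersion.eventually_eq hS hr₀ ha' hb'
    (fun r hr => by simp only [haa r hr, hbb r hr, hab r hr])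
    (Subtype.ext (by rw [haa _ hr₀, hbb _ hr₀, h₀]))
  filter_upwards [this, hS.mem_nhds hr₀] with r hr hrS
  rw [← haa r hrS, ← hbb r hrS, hr]

/-- Étale charts are D-open maps. -/
theorem IsEtaleChart.nhds_le_map (hφ : IsEtaleChart U φ) {u₀ : EuclideanSpace ℝ (Fin n)}
    (hu₀ : u₀ ∈ U) : @nhds X DiffeologicalSpace.dTopology (φ u₀) ≤ (𝓝 u₀).map φ := by
  intro W hW
  obtain ⟨N, hNW, hN, hu₀N⟩ := mem_nhds_iff.1 (Filter.mem_map.1 hW)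
  have h := hφ.2.isDiffeologicalSubmersion.isDOpen_image
    (isDOpen_of_isOpen (hN.preimage (continuous_subtype_val (p := (· ∈ U)))))
  let _ : TopologicalSpace X := DiffeologicalSpace.dTopology
  refine mem_nhds_iff.2 ⟨_, ?_, h, ⟨⟨u₀, hu₀⟩, hu₀N, rfl⟩⟩
  rintro _ ⟨v, hv, rfl⟩
  exact hNW hv

end Charts

/-! ### Smooth maps in étale charts -/

section LocalRep

variable {X Y : Type*} [DiffeologicalSpace X] [DiffeologicalSpace Y] {f : X → Y}

/-- `F` represents `f` in the étale charts `φ` and `ψ` on the open set `T`. -/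
structure IsLocalRep (f : X → Y) {n m : ℕ} (U : Set (EuclideanSpace ℝ (Fin n)))
    (φ : EuclideanSpace ℝ (Fin n) → X) (V : Set (EuclideanSpace ℝ (Fin m)))
    (ψ : EuclideanSpace ℝ (Fin m) → Y) (T : Set (EuclideanSpace ℝ (Fin n)))
    (F : EuclideanSpace ℝ (Fin n) → EuclideanSpace ℝ (Fin m)) : Prop where
  source : IsEtaleChart U φ
  target : IsEtaleChart V ψ
  isOpen : IsOpen T
  subset : T ⊆ U
  contDiffOn : ContDiffOn ℝ ∞ F T
  mapsTo : Set.MapsTo F T V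
  eq : ∀ u ∈ T, ψ (F u) = f (φ u)

variable {n m : ℕ} {U T : Set (EuclideanSpace ℝ (Fin n))} {φ : EuclideanSpace ℝ (Fin n) → X}
  {V : Set (EuclideanSpace ℝ (Fin m))} {ψ : EuclideanSpace ℝ (Fin m) → Y}
  {F : EuclideanSpace ℝ (Fin n) → EuclideanSpace ℝ (Fin m)} {u₀ : EuclideanSpace ℝ (Fin n)}

theorem IsLocalRep.differentiableAt (h : IsLocalRep f U φ V ψ T F) (hu₀ : u₀ ∈ T) :
    DifferentiableAt ℝ F u₀ :=
  (h.contDiffOn.contDiffAt (h.isOpen.mem_nhds hu₀)).differentiableAt (by simp)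

/-- Lifting `ψ` along `f` and then along `φ` gives a smooth `q` with `F ∘ q = id` near `F u₀`, by
uniqueness of lifts through `ψ`. The chain rule gives a right inverse. -/
theorem IsDiffeologicalSubmersion.surjective_fderiv (hf : IsDiffeologicalSubmersion f)
    (h : IsLocalRep f U φ V ψ T F) (hu₀ : u₀ ∈ T) : Function.Surjective (fderiv ℝ F u₀) := by
  obtain ⟨S, Q, hS, hvS, hSV, hQ, hQ₀, hfQ⟩ := hf.exists_lift h.target.1 h.target.plotOn
    (h.mapsTo hu₀) (h.eq u₀ hu₀)
  obtain ⟨S', q, hS', hvS', hSS, hq, hqU, hq₀, hφq⟩ :=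
    h.source.exists_lift hS hQ hvS (h.subset hu₀) hQ₀
  have hN : IsOpen (S' ∩ q ⁻¹' T) := hq.continuousOn.isOpen_inter_preimage hS' h.isOpen
  have hvN : F u₀ ∈ S' ∩ q ⁻¹' T := ⟨hvS', by simpa [hq₀] using hu₀⟩
  have key : ∀ᶠ v in 𝓝 (F u₀), F (q v) = v := by
    refine h.target.eventually_eq hN hvN
      (h.contDiffOn.comp (hq.mono Set.inter_subset_left) fun v hv => hv.2) contDiffOn_id
      (fun v hv => h.mapsTo hv.2) (fun v hv => hSV (hSS hv.1)) (fun v hv => ?_) (by simp [hq₀])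
    simp only [h.eq _ hv.2, hφq v hv.1, hfQ v (hSS hv.1)]
  have hqd : HasFDerivAt q (fderiv ℝ q (F u₀)) (F u₀) :=
    ((hq.contDiffAt (hS'.mem_nhds hvS')).differentiableAt (by simp)).hasFDerivAt
  have hFd : HasFDerivAt F (fderiv ℝ F u₀) (q (F u₀)) := by
    rw [hq₀]
    exact (h.differentiableAt hu₀).hasFDerivAt
  have hid := (hFd.comp (F u₀) hqd).unique
    ((hasFDerivAt_id (F u₀)).congr_of_eventuallyEq key)
  intro y
  exact ⟨fderiv ℝ q (F u₀) y,
    congrArg (fun L : EuclideanSpace ℝ (Fin m) →L[ℝ] EuclideanSpace ℝ (Fin m) => L y) hid⟩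

/-- A retraction of `f` along `ψ`, lifted through `φ`, gives a smooth `q` with `q ∘ F = id` near
`u₀`. -/
theorem IsDiffeologicalImmersion.injective_fderiv (hf : IsDiffeologicalImmersion f)
    (h : IsLocalRep f U φ V ψ T F) (hu₀ : u₀ ∈ T) : Function.Injective (fderiv ℝ F u₀) := by
  obtain ⟨S, ρ, hS, hvS, hSV, hρ, hρ₀, hρf⟩ := hf.exists_retraction h.target.1 h.target.plotOn
    (h.mapsTo hu₀) (h.eq u₀ hu₀)
  obtain ⟨S', q, hS', hvS', hSS, hq, hqU, hq₀, hφq⟩ :=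
    h.source.exists_lift hS hρ hvS (h.subset hu₀) hρ₀
  have hret := hρf h.isOpen hu₀ h.contDiffOn (h.source.plotOn.mono h.subset) h.eq rfl rfl
  have hFc : ContinuousAt F u₀ := (h.differentiableAt hu₀).continuousAt
  obtain ⟨N, hNsub, hN, huN⟩ := mem_nhds_iff.1
    (Filter.inter_mem hret (Filter.inter_mem (hFc.preimage_mem_nhds (hS'.mem_nhds hvS'))
      (h.isOpen.mem_nhds hu₀)))
  have key : ∀ᶠ u in 𝓝 u₀, q (F u) = u := by
    refine h.source.eventually_eq hN huN
      (hq.comp (h.contDiffOn.mono fun u hu => (hNsub hu).2.2) fun u hu => (hNsub hu).2.1)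
      contDiffOn_id (fun u hu => hqU (hNsub hu).2.1) (fun u hu => h.subset (hNsub hu).2.2)
      (fun u hu => ?_) hq₀
    have h1 : ρ (F u) = φ u := (hNsub hu).1
    simp only [hφq _ (hNsub hu).2.1, h1]
  have hqd : HasFDerivAt q (fderiv ℝ q (F u₀)) (F u₀) :=
    ((hq.contDiffAt (hS'.mem_nhds hvS')).differentiableAt (by simp)).hasFDerivAt
  have hid := (hqd.comp u₀ (h.differentiableAt hu₀).hasFDerivAt).unique
    ((hasFDerivAt_id u₀).congr_of_eventuallyEq key)
  intro x y hxy
  have hz : ∀ z, fderiv ℝ q (F u₀) (fderiv ℝ F u₀ z) = z := fun z =>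
    congrArg (fun L : EuclideanSpace ℝ (Fin n) →L[ℝ] EuclideanSpace ℝ (Fin n) => L z) hid
  rw [← hz x, ← hz y, hxy]

/-- At `x`, in some pair of étale charts, the derivative of `f` has the property `Q`. -/
def HasLocalRepAt (Q : ∀ {n m : ℕ},
      (EuclideanSpace ℝ (Fin n) →L[ℝ] EuclideanSpace ℝ (Fin m)) → Prop)
    (f : X → Y) (x : X) : Prop :=
  ∃ (n m : ℕ) (U : Set (EuclideanSpace ℝ (Fin n))) (φ : EuclideanSpace ℝ (Fin n) → X)
    (V : Set (EuclideanSpace ℝ (Fin m))) (ψ : EuclideanSpace ℝ (Fin m) → Y)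
    (T : Set (EuclideanSpace ℝ (Fin n)))
    (F : EuclideanSpace ℝ (Fin n) → EuclideanSpace ℝ (Fin m)), IsLocalRep f U φ V ψ T F ∧
      ∃ u ∈ T, φ u = x ∧ Q (fderiv ℝ F u)

/-- A plot is lifted through `ψ`, then by a local section `s` of `F`, and mapped back by `φ`. -/
theorem isDiffeologicalSubmersion_of_hasLocalRepAt (hf : DSmooth f)
    (h : ∀ x, HasLocalRepAt (fun A => Function.Surjective A) f x) :
    IsDiffeologicalSubmersion f := by
  refine isDiffeologicalSubmersion_of_lift hf fun k W hW P hP r₀ hr₀ x₀ hx₀ => ?_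
  obtain ⟨n, m, U, φ, V, ψ, T, F, hF, u₀, hu₀, rfl, hd⟩ := h x₀
  obtain ⟨S, s, hS, hvS, hs, hsT, hs₀, hFs⟩ :=
    exists_contDiffOn_section_of_surjective hF.isOpen hF.contDiffOn hu₀ hd
  obtain ⟨W', p, hW', hr₀', hWW, hp, hpV, hp₀, hψp⟩ :=
    hF.target.exists_lift hW hP hr₀ (hF.mapsTo hu₀) (hx₀.trans (hF.eq u₀ hu₀).symm)
  have hpW : ContDiffOn ℝ ∞ p (W' ∩ p ⁻¹' S) := hp.mono Set.inter_subset_left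
  refine ⟨W' ∩ p ⁻¹' S, fun r => φ (s (p r)), hp.continuousOn.isOpen_inter_preimage hW' hS,
    ⟨hr₀', by simpa [hp₀] using hvS⟩, fun r hr => hWW hr.1,
    hF.source.plotOn.comp_contDiffOn (hs.comp hpW fun r hr => hr.2)
      (fun r hr => hF.subset (hsT hr.2)), by simp [hp₀, hs₀], fun r hr => ?_⟩
  simp only [← hF.eq _ (hsT hr.2), hFs _ hr.2, hψp r hr.1]

theorem isDiffeologicalImmersion_of_hasLocalRepAt (hf : DSmooth f)
    (h : ∀ x, HasLocalRepAt (fun A => Function.Injective A) f x) :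
    IsDiffeologicalImmersion f := by
  refine ⟨hf, fun k W hW P hP => ?_⟩
  rintro ⟨⟨r₀, x₀⟩, hz⟩
  have hz : P r₀ = f x₀ := hz
  obtain ⟨n, m, U, φ, V, ψ, T, F, hF, u₀, hu₀, rfl, hd⟩ := h x₀
  obtain ⟨S, s, hS, hvS, hs, hsT, hs₀, hsF⟩ :=
    exists_contDiffOn_retraction_of_injective hF.isOpen hF.contDiffOn hu₀ hd
  obtain ⟨N, hNs, hN, huN⟩ := mem_nhds_iff.1 (Filter.inter_mem hsF (hF.isOpen.mem_nhds hu₀))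
  have hPe := hP.plotOn_extendConst (f (φ u₀))
  obtain ⟨W', p, hW', hr₀', hWW, hp, hpV, hp₀, hψp⟩ :=
    hF.target.exists_lift hW hPe r₀.2 (hF.mapsTo hu₀)
      ((extendConst_coe P _ r₀).trans (hz.trans (hF.eq u₀ hu₀).symm))
  have hpW : ContDiffOn ℝ ∞ p (W' ∩ p ⁻¹' S) := hp.mono Set.inter_subset_left
  have hWo : IsOpen (W' ∩ p ⁻¹' S) := hp.continuousOn.isOpen_inter_preimage hW' hS
  -- Since `ψ` need not be injective, `P r = f x` yields only `ψ (F u) = ψ (p r)`; the equality `F u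
  -- = p r` has to be imposed. It is D-open because lifts through `ψ` are unique.
  let O : Set (DPullback P f) := {z | (z.1.1 : EuclideanSpace ℝ (Fin k)) ∈ W' ∩ p ⁻¹' S ∧
    ∃ u ∈ N, φ u = z.1.2 ∧ F u = p z.1.1}
  have hO : IsDOpen O := by
    refine isOpen_iff_preimages_plots.2 fun l c hc => isOpen_iff_mem_nhds.2 ?_
    rintro t₀ ⟨ht₀, u₁, hu₁, hφu, hFu⟩
    have hc1 : ContDiff ℝ ∞ fun t => ((c t).1.1 : EuclideanSpace ℝ (Fin k)) :=
      IsPlot.contDiff (X := EuclideanSpace ℝ (Fin k)) hc.1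
    have hc2 : IsPlot fun t => (c t).1.2 := hc.2
    obtain ⟨T₁, q, hT₁, ht₁, -, hq, hqU, hq₀, hφq⟩ := hF.source.exists_lift
      (P := fun t => (c t).1.2) isOpen_univ
      (fun j g hg _ => isPlot_reparam hc2 hg) (Set.mem_univ t₀)
      (hF.subset (hNs hu₁).2) hφu.symm
    let R : Set (EuclideanSpace ℝ (Fin l)) := (T₁ ∩ q ⁻¹' N) ∩
      (fun t => ((c t).1.1 : EuclideanSpace ℝ (Fin k))) ⁻¹' (W' ∩ p ⁻¹' S)
    have hR : IsOpen R :=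
      (hq.continuousOn.isOpen_inter_preimage hT₁ hN).inter (hWo.preimage hc1.continuous)
    have htR : t₀ ∈ R := ⟨⟨ht₁, by simpa [hq₀] using hu₁⟩, ht₀⟩
    have key : ∀ᶠ t in 𝓝 t₀, F (q t) = p (c t).1.1 := by
      refine hF.target.eventually_eq hR htR
        (hF.contDiffOn.comp (hq.mono fun t ht => ht.1.1) fun t ht => (hNs ht.1.2).2)
        (hp.comp hc1.contDiffOn fun t ht => ht.2.1)
        (fun t ht => hF.mapsTo (hNs ht.1.2).2) (fun t ht => hpV ht.2.1) (fun t ht => ?_)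
        (by simp [hq₀, hFu])
      simp only [hF.eq _ (hNs ht.1.2).2, hφq t ht.1.1, hψp _ ht.2.1,
        extendConst_coe]
      exact (c t).2.symm
    filter_upwards [key, hR.mem_nhds htR] with t ht htR
    exact ⟨htR.2, q t, htR.1.2, hφq t htR.1.1, ht⟩
  refine ⟨O, Subtype.val ⁻¹' (W' ∩ p ⁻¹' S), fun z hz => hz.1,
    fun r => (r.1, φ (s (p r.1.1))), hO,
    ⟨⟨hr₀', by simpa [hp₀] using hvS⟩, u₀, huN, rfl, hp₀.symm⟩,
    hWo.preimage continuous_subtype_val, ?_, ?_⟩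
  · refine dSmooth_subtype_val.prodMk fun j g hg => ?_
    have hpl : PlotOn (fun r => φ (s (p r))) (W' ∩ p ⁻¹' S) :=
      hF.source.plotOn.comp_contDiffOn (hs.comp hpW fun r hr => hr.2)
        (fun r hr => hF.subset (hsT hr.2))
    exact hpl j (fun t => (g t).1.1) (IsPlot.contDiff (X := EuclideanSpace ℝ (Fin k)) hg)
      fun t => (g t).2
  · rintro z ⟨-, u, hu, hφu, hFu⟩
    refine Prod.ext rfl ?_
    show φ (s (p z.1.1)) = z.1.2
    rw [← hFu, ← hφu]
    exact congrArg φ (hNs hu).1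

end LocalRep

/-! ### Families of smooth maps on compact étale manifolds -/

section Families

variable {K M : Type*} [DiffeologicalSpace K] [DiffeologicalSpace M] {k n m : ℕ}
  {p : EuclideanSpace ℝ (Fin k) → DSmoothMap K M} {r₀ : EuclideanSpace ℝ (Fin k)}
  {U : Set (EuclideanSpace ℝ (Fin n))} {φ : EuclideanSpace ℝ (Fin n) → K}
  {V : Set (EuclideanSpace ℝ (Fin m))} {ψ : EuclideanSpace ℝ (Fin m) → M}
  {u₀ : EuclideanSpace ℝ (Fin n)} {v₀ : EuclideanSpace ℝ (Fin m)}

theorem plotOn_family (hp : IsPlot p) (hφ : IsEtaleChart U φ) :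
    PlotOn (fun z : EuclideanSpace ℝ (Fin k) × EuclideanSpace ℝ (Fin n) => p z.1 (φ z.2))
      (Set.univ ×ˢ U) := fun l q hq hqT =>
  hp l (fun t => ((q t).1, φ (q t).2))
    ⟨(contDiff_fst.comp hq).isPlot,
      hφ.plotOn l (fun t => (q t).2) (contDiff_snd.comp hq) fun t => (hqT t).2⟩

/-- Local representatives of a plot of smooth maps, depending smoothly on the parameter. -/
theorem exists_family_rep (hp : IsPlot p) (hφ : IsEtaleChart U φ) (hψ : IsEtaleChart V ψ)
    (hu₀ : u₀ ∈ U) (hv₀ : v₀ ∈ V) (h : p r₀ (φ u₀) = ψ v₀) :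
    ∃ (T : Set (EuclideanSpace ℝ (Fin k) × EuclideanSpace ℝ (Fin n)))
      (F : EuclideanSpace ℝ (Fin k) × EuclideanSpace ℝ (Fin n) → EuclideanSpace ℝ (Fin m)),
      IsOpen T ∧ (r₀, u₀) ∈ T ∧ ContDiffOn ℝ ∞ F T ∧ Set.MapsTo F T V ∧
      (∀ z ∈ T, ψ (F z) = p z.1 (φ z.2)) ∧
      ∀ r, IsLocalRep (p r) U φ V ψ {u | (r, u) ∈ T} (fun u => F (r, u)) := by
  obtain ⟨T, F, hT, hrT, hTU, hF, hFV, -, hψF⟩ :=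
    hψ.exists_lift (isOpen_univ.prod hφ.1) (plotOn_family hp hφ) (r₀ := (r₀, u₀))
      ⟨trivial, hu₀⟩ hv₀ h
  have hc : ∀ r : EuclideanSpace ℝ (Fin k),
      ContDiff ℝ ∞ fun u : EuclideanSpace ℝ (Fin n) => (r, u) :=
    fun r => contDiff_const.prodMk contDiff_id
  exact ⟨T, F, hT, hrT, hF, hFV, hψF, fun r => ⟨hφ, hψ, hT.preimage (hc r).continuous,
    fun u hu => (hTU hu).2, hF.comp (hc r).contDiffOn fun u hu => hu, fun u hu => hFV hu,
    fun u hu => hψF _ hu⟩⟩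

theorem fderiv_slice {E E' G : Type*} [NormedAddCommGroup E] [NormedSpace ℝ E]
    [NormedAddCommGroup E'] [NormedSpace ℝ E'] [NormedAddCommGroup G] [NormedSpace ℝ G]
    {F : E × E' → G} {r : E} {u : E'} (h : DifferentiableAt ℝ F (r, u)) :
    fderiv ℝ (fun u => F (r, u)) u =
      (fderiv ℝ F (r, u)).comp (ContinuousLinearMap.inr ℝ E E') :=
  (h.hasFDerivAt.comp u (hasFDerivAt_prodMk_right r u)).fderiv

/-- In a D-compact étale manifold, properties that hold locally uniformly near `r₀` hold
uniformly. -/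
theorem eventually_forall_of_charts (hKc : IsDCompact K) {R : EuclideanSpace ℝ (Fin k) → K → Prop}
    (h : ∀ x, ∃ (n : ℕ) (U : Set (EuclideanSpace ℝ (Fin n))) (φ : EuclideanSpace ℝ (Fin n) → K),
      ∃ u ∈ U, IsEtaleChart U φ ∧ φ u = x ∧ ∀ᶠ z in 𝓝 (r₀, u), R z.1 (φ z.2)) :
    ∀ᶠ r in 𝓝 r₀, ∀ x, R r x := by
  let _ : TopologicalSpace K := DiffeologicalSpace.dTopology
  have : CompactSpace K := hKc
  have key := (isCompact_univ (X := K)).eventually_forall_of_forall_eventually (x₀ := r₀)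
    (P := R) fun x _ => by
      obtain ⟨n, U, φ, u, hu, hφ, rfl, hR⟩ := h x
      rw [nhds_prod_eq] at hR ⊢
      -- Charts are D-open, so neighbourhoods of `(r₀, u)` map to neighbourhoods of `(r₀, φ u)` in
      -- the product topology.
      have h1 : 𝓝 r₀ ×ˢ 𝓝 (φ u) ≤ Filter.map (Prod.map id φ) (𝓝 r₀ ×ˢ 𝓝 u) := by
        rw [← Filter.prod_map_map_eq', Filter.map_id]
        exact Filter.prod_mono le_rfl (hφ.nhds_le_map hu)
      exact h1 (Filter.mem_map.2 hR)
  filter_upwards [key] with r hr x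
  exact hr x trivial

/-- Openness of a property of the derivative in étale charts. -/
theorem eventually_hasLocalRepAt (hK : IsDiffeologicalEtaleManifold K)
    (hM : IsDiffeologicalEtaleManifold M) (hKc : IsDCompact K) (hp : IsPlot p)
    {Q : ∀ {n m : ℕ}, (EuclideanSpace ℝ (Fin n) →L[ℝ] EuclideanSpace ℝ (Fin m)) → Prop}
    (hQ : ∀ {n m : ℕ} (A : EuclideanSpace ℝ (Fin n) →L[ℝ] EuclideanSpace ℝ (Fin m)),
      Q A → ∀ᶠ A' in 𝓝 A, Q A')
    (hr₀ : ∀ {n m : ℕ} {U T : Set (EuclideanSpace ℝ (Fin n))}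
      {φ : EuclideanSpace ℝ (Fin n) → K} {V : Set (EuclideanSpace ℝ (Fin m))}
      {ψ : EuclideanSpace ℝ (Fin m) → M}
      {F : EuclideanSpace ℝ (Fin n) → EuclideanSpace ℝ (Fin m)} {u₀ : EuclideanSpace ℝ (Fin n)},
      IsLocalRep (p r₀) U φ V ψ T F → u₀ ∈ T → Q (fderiv ℝ F u₀)) :
    ∀ᶠ r in 𝓝 r₀, ∀ x, HasLocalRepAt Q (p r) x := by
  obtain ⟨n, hcK⟩ := hK.exists_isEtaleChart
  obtain ⟨m, hcM⟩ := hM.exists_isEtaleChart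
  refine eventually_forall_of_charts hKc fun x => ?_
  obtain ⟨U, φ, u₀, hu₀, hφ, rfl⟩ := hcK x
  obtain ⟨V, ψ, v₀, hv₀, hψ, hv⟩ := hcM (p r₀ (φ u₀))
  refine ⟨n, U, φ, u₀, hu₀, hφ, rfl, ?_⟩
  obtain ⟨T, F, hT, hrT, hF, -, -, hrep⟩ := exists_family_rep hp hφ hψ hu₀ hv₀ hv.symm
  have hdiff : ∀ z ∈ T, DifferentiableAt ℝ F z := fun z hz =>
    (hF.contDiffAt (hT.mem_nhds hz)).differentiableAt (by simp)
  have h₀ := hr₀ (hrep r₀) (u₀ := u₀) hrT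
  rw [fderiv_slice (hdiff _ hrT)] at h₀
  -- The derivative in the point variable is continuous in parameter and point together, so the open
  -- condition `Q` spreads.
  have hc : ContinuousAt (fun z => (fderiv ℝ F z).comp (ContinuousLinearMap.inr ℝ _ _))
      (r₀, u₀) :=
    ((hF.continuousOn_fderiv_of_isOpen hT (by simp)).continuousAt
      (hT.mem_nhds hrT)).clm_comp continuousAt_const
  filter_upwards [hc.eventually (hQ _ h₀), hT.mem_nhds hrT] with z hz hzT
  refine ⟨n, m, U, φ, V, ψ, _, _, hrep z.1, z.2, hzT, rfl, ?_⟩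
  rw [fderiv_slice (hdiff _ hzT)]
  exact hz

theorem isDOpen_iff_eventually {X : Type*} [DiffeologicalSpace X] {s : Set X} : IsDOpen s ↔
    ∀ (k : ℕ) (p : EuclideanSpace ℝ (Fin k) → X), IsPlot p → ∀ r₀, p r₀ ∈ s →
      ∀ᶠ r in 𝓝 r₀, p r ∈ s := by
  simp only [IsDOpen]
  refine isOpen_iff_preimages_plots.trans ?_
  simp only [isOpen_iff_mem_nhds]
  rfl

variable (hK : IsDiffeologicalEtaleManifold K) (hM : IsDiffeologicalEtaleManifold M)
  (hKc : IsDCompact K)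

include hK hM hKc

theorem isDOpen_setOf_submersion :
    IsDOpen {f : DSmoothMap K M | IsDiffeologicalSubmersion f} := by
  refine isDOpen_iff_eventually.2 fun k p hp r₀ hr₀ => ?_
  filter_upwards [eventually_hasLocalRepAt hK hM hKc hp (Q := fun A => Function.Surjective A)
    (fun A hA => eventually_surjective hA)
    fun h hu => IsDiffeologicalSubmersion.surjective_fderiv hr₀ h hu] with r hr
  exact isDiffeologicalSubmersion_of_hasLocalRepAt (p r).dSmooth' hr

theorem isDOpen_setOf_immersion :
    IsDOpen {f : DSmoothMap K M | IsDiffeologicalImmersion f} := by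
  refine isDOpen_iff_eventually.2 fun k p hp r₀ hr₀ => ?_
  filter_upwards [eventually_hasLocalRepAt hK hM hKc hp (Q := fun A => Function.Injective A)
    (fun A hA => eventually_injective hA)
    fun h hu => IsDiffeologicalImmersion.injective_fderiv hr₀ h hu] with r hr
  exact isDiffeologicalImmersion_of_hasLocalRepAt (p r).dSmooth' hr

theorem isDOpen_setOf_etale : IsDOpen {f : DSmoothMap K M | IsDiffeologicalEtale f} := by
  simp only [isDiffeologicalEtale_iff]
  exact (isDOpen_setOf_submersion hK hM hKc).inter (isDOpen_setOf_immersion hK hM hKc)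

theorem isDOpen_setOf_localSubduction (hMh : IsDHausdorff M) :
    IsDOpen {f : DSmoothMap K M | IsLocalSubduction f} := by
  refine isDOpen_iff_eventually.2 fun k p hp r₀ hr₀ => ?_
  obtain ⟨hsurj, hsub⟩ := isLocalSubduction_iff.1 hr₀
  let _ : TopologicalSpace K := DiffeologicalSpace.dTopology
  let _ : TopologicalSpace M := DiffeologicalSpace.dTopology
  have : CompactSpace K := hKc
  have : T2Space M := hMh
  have hcont : ∀ r, Continuous (p r) := fun r => (p r).dSmooth'.continuous
  have hcomp : CompactSpace M := ⟨by
    rw [← hsurj.range_eq]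
    exact isCompact_range (hcont r₀)⟩
  -- The domain of a plot is connected, so a plot stays in one component; hence components are
  -- D-open.
  have hopen : ∀ y : M, IsOpen (connectedComponent y) := fun y => by
    refine isOpen_iff_preimages_plots.2 fun l q hq => isOpen_iff_mem_nhds.2 fun t ht => ?_
    refine Filter.univ_mem' fun t' => ?_
    have hr : IsPreconnected (Set.range q) := isPreconnected_range hq.continuous
    have h1 := hr.subset_connectedComponent ⟨t, rfl⟩ ⟨t', rfl⟩
    rwa [← connectedComponent_eq ht] at h1
  obtain ⟨s, hs⟩ := isCompact_univ.elim_finite_subcover (fun y : M => connectedComponent y)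
    hopen fun y _ => Set.mem_iUnion.2 ⟨y, mem_connectedComponent⟩
  choose g hg using hsurj
  have hhit : ∀ᶠ r in 𝓝 r₀, ∀ y ∈ s, p r (g y) ∈ connectedComponent y := by
    refine (Filter.eventually_all_finset s).2 fun y _ => ?_
    have hpl : IsPlot fun r => p r (g y) := hp k (fun r => (r, g y)) ⟨isPlot_id, isPlot_const⟩
    exact ((hopen y).preimage hpl.continuous).mem_nhds (by
      simp only [Set.mem_preimage, hg]
      exact mem_connectedComponent)
  filter_upwards [hhit, isDOpen_iff_eventually.1 (isDOpen_setOf_submersion hK hM hKc) k p hp r₀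
    hsub] with r hr hrs
  refine isLocalSubduction_iff.2 ⟨fun y => ?_, hrs⟩
  -- Closed as a compact subset of a Hausdorff space, open because submersions are D-open. Such a
  -- set contains every component it meets.
  have hclopen : IsClopen (Set.range (p r)) := by
    refine ⟨(isCompact_range (hcont r)).isClosed, ?_⟩
    rw [← Set.image_univ]
    exact hrs.isDOpen_image isDOpen_univ
  obtain ⟨y₀, hy₀, hy⟩ := Set.mem_iUnion₂.1 (hs (Set.mem_univ y))
  exact isPreconnected_connectedComponent.subset_isClopen hclopen ⟨_, hr y₀ hy₀, g y₀, rfl⟩ hy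

end Families

/-! ### Usual manifolds and injective maps -/

section Usual

variable {K M : Type*} [DiffeologicalSpace K] [DiffeologicalSpace M]

/-- Plots are continuous for the manifold topology, so the D-topology is at least as fine. -/
theorem IsUsualManifold.isDHausdorff (hM : IsUsualManifold M) : IsDHausdorff M := by
  obtain ⟨n, t, _, hT2, -, -, hplot⟩ := hM
  have hle : ∀ s : Set M, IsOpen s → IsDOpen s := fun s hs =>
    isOpen_iff_preimages_plots.2 fun k p hp => hs.preimage ((hplot k p).1 hp).continuous
  refine @T2Space.mk M DiffeologicalSpace.dTopology fun x y hxy => ?_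
  obtain ⟨u, v, hu, hv, hx, hy, huv⟩ := t2_separation hxy
  exact ⟨u, v, hle u hu, hle v hv, hx, hy, huv⟩

/-- The charts of a usual manifold are injective étale charts. -/
theorem IsUsualManifold.exists_isEtaleChart (hM : IsUsualManifold M) :
    ∃ n : ℕ, ∀ y : M, ∃ (V : Set (EuclideanSpace ℝ (Fin n)))
      (ψ : EuclideanSpace ℝ (Fin n) → M), ∃ v ∈ V, IsEtaleChart V ψ ∧ Set.InjOn ψ V ∧ ψ v = y := by
  obtain ⟨n, t, _, hT2, -, hman, hplot⟩ := hM
  refine ⟨n, fun y => ?_⟩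
  let e := chartAt (EuclideanSpace ℝ (Fin n)) y
  have hy : y ∈ e.source := mem_chart_source _ y
  have hes : ContMDiffOn (𝓡 n) (𝓡 n) ∞ e.symm e.target := contMDiffOn_chart_symm
  have he : ContMDiffOn (𝓡 n) (𝓡 n) ∞ e e.source := contMDiffOn_chart
  have hsrc : IsDOpen e.source := isOpen_iff_preimages_plots.2 fun k p hp =>
    e.open_source.preimage ((hplot k p).1 hp).continuous
  refine ⟨e.target, e.symm, e y, e.map_source hy, ⟨e.open_target, ?_, ?_⟩, e.symm.injOn,
    e.left_inv hy⟩
  · intro k q hq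
    have hq' : ContMDiff (𝓡 k) (𝓡 n) ∞ fun t => (q t : EuclideanSpace ℝ (Fin n)) :=
      (IsPlot.contDiff (X := EuclideanSpace ℝ (Fin n)) hq).contMDiff
    exact (hplot k _).2 (hes.comp_contMDiff hq' fun t => (q t).2)
  · intro k W hW P hP z₀
    have hmaps : ∀ z : DPullback P (fun u : e.target => e.symm u), P z.1.1 ∈ e.source :=
      fun z => by
        rw [z.2]
        exact e.map_target z.1.2.2
    refine ⟨Set.univ, P ⁻¹' e.source, fun z _ => hmaps z, isDOpen_univ, trivial,
      isDOpen_preimage hP hsrc, ((dSmooth_proj _ _).comp dSmooth_subtype_val).subtype_mk _,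
      fun r => ⟨⟨(r.1, ⟨e (P r.1), e.map_source r.2⟩), (e.left_inv r.2).symm⟩, trivial⟩,
      ?_, fun z => ?_, fun r => rfl⟩
    · intro l q hq
      have hPq : IsPlot fun t => P (q t).1 := hP l (fun t => (q t).1) hq
      have h1 : ContMDiff (𝓡 l) (𝓡 n) ∞ fun t => e (P (q t).1) :=
        he.comp_contMDiff ((hplot l _).1 hPq) fun t => (q t).2
      exact ⟨hq, h1.contDiff.isPlot⟩
    · refine Subtype.ext (Subtype.ext (Prod.ext rfl (Subtype.ext ?_)))
      show e (P z.1.1.1) = z.1.1.2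
      rw [z.1.2]
      exact e.right_inv z.1.1.2.2

/-- On D-compact spaces, diffeological embeddings into D-Hausdorff spaces are the same as injective
diffeological immersions. -/
theorem isDiffeologicalEmbedding_iff (hKc : IsDCompact K) (hMh : IsDHausdorff M) {f : K → M} :
    IsDiffeologicalEmbedding f ↔ Function.Injective f ∧ IsDiffeologicalImmersion f := by
  let _ : TopologicalSpace K := DiffeologicalSpace.dTopology
  let _ : TopologicalSpace M := DiffeologicalSpace.dTopology
  have : CompactSpace K := hKc
  have : T2Space M := hMh
  refine ⟨fun h => ⟨Topology.IsEmbedding.injective h.2, h.1⟩, fun h => ⟨h.2, ?_⟩⟩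
  have hc : Continuous f := DSmooth.continuous h.2.1
  exact (hc.isClosedEmbedding h.1).isEmbedding

theorem injOn_of_injective_fderiv {E E' : Type*} [NormedAddCommGroup E] [NormedSpace ℝ E]
    [FiniteDimensional ℝ E] [NormedAddCommGroup E'] [NormedSpace ℝ E'] [FiniteDimensional ℝ E']
    {F : E → E'} {T : Set E} (hT : IsOpen T) (hF : ContDiffOn ℝ ∞ F T) {u₀ : E} (hu₀ : u₀ ∈ T)
    (hd : Function.Injective (fderiv ℝ F u₀)) : ∃ N ∈ 𝓝 u₀, Set.InjOn F N := by
  obtain ⟨S, s, -, -, -, -, -, hs⟩ := exists_contDiffOn_retraction_of_injective hT hF hu₀ hd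
  refine ⟨_, hs, fun u hu v hv huv => ?_⟩
  have hu : s (F u) = u := hu
  have hv : s (F v) = v := hv
  rw [← hu, ← hv, huv]

/-- If the partial derivative of `F` in the second variable is injective, then `F` is locally
injective in the second variable, uniformly in the first. -/
theorem injOn_slices_of_injective_fderiv {E E' G : Type*} [NormedAddCommGroup E]
    [NormedSpace ℝ E] [FiniteDimensional ℝ E] [NormedAddCommGroup E'] [NormedSpace ℝ E']
    [FiniteDimensional ℝ E'] [NormedAddCommGroup G] [NormedSpace ℝ G] [FiniteDimensional ℝ G]
    {F : E × E' → G} {T : Set (E × E')} (hT : IsOpen T) (hF : ContDiffOn ℝ ∞ F T) {r₀ : E}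
    {u₀ : E'} (hu₀ : (r₀, u₀) ∈ T)
    (hd : Function.Injective (fderiv ℝ (fun u => F (r₀, u)) u₀)) :
    ∃ N ∈ 𝓝 (r₀, u₀), ∀ r u v, (r, u) ∈ N → (r, v) ∈ N → F (r, u) = F (r, v) → u = v := by
  have hFd : DifferentiableAt ℝ F (r₀, u₀) :=
    (hF.contDiffAt (hT.mem_nhds hu₀)).differentiableAt (by simp)
  rw [fderiv_slice hFd] at hd
  -- Keeping the parameter as a component, `(r, u) ↦ (r, F (r, u))` has block triangular, hence
  -- injective, derivative; its local injectivity is uniform in `r`.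
  have hGd : HasFDerivAt (fun z : E × E' => (z.1, F z))
      ((ContinuousLinearMap.fst ℝ E E').prod (fderiv ℝ F (r₀, u₀))) (r₀, u₀) :=
    hasFDerivAt_fst.prodMk hFd.hasFDerivAt
  obtain ⟨N, hN, hinj⟩ := injOn_of_injective_fderiv hT
    (contDiff_fst.contDiffOn.prodMk hF) hu₀ (F := fun z : E × E' => (z.1, F z)) (by
      rw [hGd.fderiv, injective_iff_map_eq_zero]
      rintro ⟨a, b⟩ hab
      obtain ⟨h1, h2⟩ := Prod.mk.inj hab
      have ha : a = 0 := h1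
      subst ha
      have hb : b = 0 := (injective_iff_map_eq_zero _).1 hd b h2
      rw [hb]
      rfl)
  exact ⟨N, hN, fun r u v hu hv huv =>
    (Prod.mk.inj (hinj hu hv (Prod.ext rfl huv))).2⟩

/-- Smoothness gives continuity for the D-topology of the product `ℝᵏ × K`; D-open charts of `K`
transfer it to the product of the topologies. -/
theorem tendsto_family (hK : IsDiffeologicalEtaleManifold K) {k : ℕ}
    {p : EuclideanSpace ℝ (Fin k) → DSmoothMap K M} (hp : IsPlot p)
    (r₀ : EuclideanSpace ℝ (Fin k)) (x₀ : K) :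
    Filter.Tendsto (fun z : EuclideanSpace ℝ (Fin k) × K => p z.1 z.2)
      (𝓝 r₀ ×ˢ @nhds K DiffeologicalSpace.dTopology x₀)
      (@nhds M DiffeologicalSpace.dTopology (p r₀ x₀)) := by
  obtain ⟨n, hcK⟩ := hK.exists_isEtaleChart
  obtain ⟨U, φ, u₀, hu₀, hφ, rfl⟩ := hcK x₀
  let _ : TopologicalSpace K := DiffeologicalSpace.dTopology
  let _ : TopologicalSpace M := DiffeologicalSpace.dTopology
  have h1 : 𝓝 r₀ ×ˢ 𝓝 (φ u₀) ≤ Filter.map (Prod.map id φ) (𝓝 r₀ ×ˢ 𝓝 u₀) := by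
    rw [← Filter.prod_map_map_eq', Filter.map_id]
    exact Filter.prod_mono le_rfl (hφ.nhds_le_map hu₀)
  refine Filter.Tendsto.mono_left ?_ h1
  rw [Filter.tendsto_map'_iff, ← nhds_prod_eq, tendsto_nhds]
  intro O hO hrO
  exact (plotOn_family hp hφ).eventually_mem (isOpen_univ.prod hφ.1) hO
    (r₀ := (r₀, u₀)) ⟨trivial, hu₀⟩ hrO

theorem eventually_injective_of_immersion (hK : IsDiffeologicalEtaleManifold K)
    (hKc : IsDCompact K) (hM : IsUsualManifold M) {k : ℕ}
    {p : EuclideanSpace ℝ (Fin k) → DSmoothMap K M} (hp : IsPlot p)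
    {r₀ : EuclideanSpace ℝ (Fin k)} (hinj : Function.Injective (p r₀))
    (himm : IsDiffeologicalImmersion (p r₀)) : ∀ᶠ r in 𝓝 r₀, Function.Injective (p r) := by
  obtain ⟨n, hcK⟩ := hK.exists_isEtaleChart
  obtain ⟨m, hcM⟩ := hM.exists_isEtaleChart
  let _ : TopologicalSpace K := DiffeologicalSpace.dTopology
  let _ : TopologicalSpace M := DiffeologicalSpace.dTopology
  have : CompactSpace K := hKc
  have : T2Space M := hM.isDHausdorff
  have key := (isCompact_univ (X := K × K)).eventually_forall_of_forall_eventually (x₀ := r₀)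
    (P := fun r w => p r w.1 = p r w.2 → w.1 = w.2) fun w _ => by
      obtain ⟨x, y⟩ := w
      rw [nhds_prod_eq, nhds_prod_eq]
      by_cases hxy : x = y
      · subst hxy
        obtain ⟨U, φ, u₀, hu₀, hφ, rfl⟩ := hcK x
        obtain ⟨V, ψ, v₀, hv₀, hψ, hψi, hv⟩ := hcM (p r₀ (φ u₀))
        obtain ⟨T, F, hT, hrT, hF, hFV, hψF, hrep⟩ :=
          exists_family_rep hp hφ hψ hu₀ hv₀ hv.symm
        obtain ⟨N, hN, hNi⟩ := injOn_slices_of_injective_fderiv hT hF hrT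
          (himm.injective_fderiv (hrep r₀) hrT)
        have h1 : 𝓝 r₀ ×ˢ (𝓝 (φ u₀) ×ˢ 𝓝 (φ u₀)) ≤
            Filter.map (Prod.map id (Prod.map φ φ)) (𝓝 r₀ ×ˢ (𝓝 u₀ ×ˢ 𝓝 u₀)) := by
          rw [← Filter.prod_map_map_eq', Filter.map_id, ← Filter.prod_map_map_eq']
          exact Filter.prod_mono le_rfl
            (Filter.prod_mono (hφ.nhds_le_map hu₀) (hφ.nhds_le_map hu₀))
        refine h1 (Filter.mem_map.2 ?_)
        have hN' := Filter.inter_mem hN (hT.mem_nhds hrT)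
        have t1 : Filter.Tendsto (fun z : EuclideanSpace ℝ (Fin k) ×
            (EuclideanSpace ℝ (Fin n) × EuclideanSpace ℝ (Fin n)) => (z.1, z.2.1))
            (𝓝 r₀ ×ˢ (𝓝 u₀ ×ˢ 𝓝 u₀)) (𝓝 (r₀, u₀)) := by
          rw [nhds_prod_eq]
          exact Filter.tendsto_fst.prodMk (Filter.tendsto_fst.comp Filter.tendsto_snd)
        have t2 : Filter.Tendsto (fun z : EuclideanSpace ℝ (Fin k) ×
            (EuclideanSpace ℝ (Fin n) × EuclideanSpace ℝ (Fin n)) => (z.1, z.2.2))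
            (𝓝 r₀ ×ˢ (𝓝 u₀ ×ˢ 𝓝 u₀)) (𝓝 (r₀, u₀)) := by
          rw [nhds_prod_eq]
          exact Filter.tendsto_fst.prodMk (Filter.tendsto_snd.comp Filter.tendsto_snd)
        filter_upwards [t1 hN', t2 hN']
        rintro ⟨r, u, v⟩ ⟨hu, huT⟩ ⟨hv, hvT⟩ huv
        -- Injectivity of `ψ` on `V` turns equal values in `M` into equal values of `F`; this is
        -- where charts of a usual manifold are needed.
        refine congrArg φ (hNi r u v hu hv (hψi (hFV huT) (hFV hvT) ?_))
        rw [hψF _ huT, hψF _ hvT]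
        exact huv
      -- Distinct points have distinct images under `p r₀`, and disjoint neighbourhoods of these
      -- images keep nearby values apart.
      · obtain ⟨A, B, hA, hB, hxA, hyB, hAB⟩ := t2_separation (hinj.ne hxy)
        have t1 := (tendsto_family hK hp r₀ x).comp (Filter.tendsto_fst.prodMk
          (Filter.tendsto_fst.comp (Filter.tendsto_snd (f := 𝓝 r₀) (g := 𝓝 x ×ˢ 𝓝 y))))
        have t2 := (tendsto_family hK hp r₀ y).comp (Filter.tendsto_fst.prodMk
          (Filter.tendsto_snd.comp (Filter.tendsto_snd (f := 𝓝 r₀) (g := 𝓝 x ×ˢ 𝓝 y))))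
        filter_upwards [t1 (hA.mem_nhds hxA), t2 (hB.mem_nhds hyB)] with z hzA hzB hz
        exact absurd (show p z.1 z.2.2 ∈ B from hzB)
          (Set.disjoint_left.1 hAB (by rw [← hz]; exact hzA))
  filter_upwards [key] with r hr x y hxy
  exact hr (x, y) trivial hxy

end Usual

/-! ### The stability theorem -/

theorem theorem1p8 {K M : Type*} [DiffeologicalSpace K] [DiffeologicalSpace M]
    (hK : IsDiffeologicalEtaleManifold K) (hM : IsDiffeologicalEtaleManifold M)
    (hKc : IsDCompact K) :
    -- (a)
    (IsDOpen {f : DSmoothMap K M | IsDiffeologicalSubmersion f} ∧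
      IsDOpen {f : DSmoothMap K M | IsDiffeologicalImmersion f} ∧
      IsDOpen {f : DSmoothMap K M | IsDiffeologicalEtale f} ∧
      (IsDHausdorff M → IsDOpen {f : DSmoothMap K M | IsLocalSubduction f})) ∧
    -- (b)
    (IsUsualManifold M →
      IsDOpen {f : DSmoothMap K M | Function.Injective f ∧ IsDiffeologicalImmersion f} ∧
      IsDOpen {f : DSmoothMap K M | IsDiffeologicalEmbedding f} ∧
      IsDOpen {f : DSmoothMap K M | IsDiffeomorphism f}) ∧
    -- (c)
    (IsDHausdorff M →
      IsDOpen {f : InjSmoothMap K M | IsDiffeologicalEmbedding f.1} ∧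
      IsDOpen {f : InjSmoothMap K M | IsDiffeomorphism f.1}) := by
  have hsubd := isDOpen_setOf_localSubduction hK hM hKc
  have himm := isDOpen_setOf_immersion hK hM hKc
  refine ⟨⟨isDOpen_setOf_submersion hK hM hKc, himm, isDOpen_setOf_etale hK hM hKc, hsubd⟩,
    fun hMu => ?_, fun hMh => ?_⟩
  · have hinj : IsDOpen {f : DSmoothMap K M | Function.Injective f ∧
        IsDiffeologicalImmersion f} := by
      refine isDOpen_iff_eventually.2 fun k p hp r₀ hr₀ => ?_
      filter_upwards [eventually_injective_of_immersion hK hKc hMu hp hr₀.1 hr₀.2,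
        isDOpen_iff_eventually.1 himm k p hp r₀ hr₀.2] with r h1 h2
      exact ⟨h1, h2⟩
    refine ⟨hinj, ?_, ?_⟩
    · simpa only [isDiffeologicalEmbedding_iff hKc hMu.isDHausdorff] using hinj
    -- Diffeomorphisms are the injective immersions that are also local subductions.
    · convert hinj.inter (hsubd hMu.isDHausdorff) using 1
      ext f
      exact ⟨fun h => ⟨⟨(isDiffeomorphism_iff.1 h).1, h.isDiffeologicalImmersion⟩,
        (isDiffeomorphism_iff.1 h).2⟩, fun h => isDiffeomorphism_iff.2 ⟨h.1.1, h.2⟩⟩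
  · refine ⟨?_, ?_⟩
    -- On injective maps, being an embedding is just being an immersion, so the class is the
    -- preimage of a D-open set under the inclusion.
    · convert isDOpen_preimage (dSmooth_subtype_val (s := fun f : DSmoothMap K M =>
        Function.Injective f)) himm using 1
      ext f
      exact ⟨fun h => h.1, fun h => (isDiffeologicalEmbedding_iff hKc hMh).2 ⟨f.2, h⟩⟩
    · convert isDOpen_preimage (dSmooth_subtype_val (s := fun f : DSmoothMap K M =>
        Function.Injective f)) (hsubd hMh) using 1
      ext f
      exact ⟨fun h => (isDiffeomorphism_iff.1 h).2, fun h => isDiffeomorphism_iff.2 ⟨f.2, h⟩⟩
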